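/- Let $\mathbb F$ be a field, $d\ge 0$ an integer, and $p=(\{\theta_i\}_{i=0}^d;\{\theta^*_i\}_{i=0}^d)$ a feasible sequence of scalars in $\mathbb F$: the $\theta_i$ are mutually distinct, the $\theta^*_i$ are mutually distinct, and the expressions $\frac{\theta_{i-2}-\theta_{i+1}}{\theta_{i-1}-\theta_i}$, $\frac{\theta^*_{i-2}-\theta^*_{i+1}}{\theta^*_{i-1}-\theta^*_i}$ are equal and independent of $i$ for $2\le i\le d-1$. Let $T$ be the unital associative $\mathbb F$-algebra with generators $a,\{e_i\}_{i=0}^d,a^*,\{e^*_i\}_{i=0}^d$ and relations $$e_ie_j=\delta_{ij}e_i,\quad e^*_ie^*_j=\delta_{ij}e^*_i,\quad 1=\sum_{i=0}^d e_i,\quad 1=\sum_{i=0}^d e^*_i,\quad a=\sum_{i=0}^d\theta_ie_i,\quad a^*=\sum_{i=0}^d\theta^*_ie^*_i,$$ $$e^*_ia^ke^*_j=0,\qquad e_i{a^*}^ke_j=0\qquad(0\le i,j\le d,\ 0\le k<|i-j|).$$ Let $\tilde T$ be the unital associative $\mathbb F$-algebra with generators $\{\varepsilon_i\}_{i=0}^d,\{\varepsilon^*_i\}_{i=0}^d$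 and relations $$\varepsilon_i\varepsilon_j=\delta_{ij}\varepsilon_i,\qquad \varepsilon^*_i\varepsilon^*_j=\delta_{ij}\varepsilon^*_i\qquad(0\le i,j\le d),$$ $$0=\sum_{\ell=0}^d\theta_\ell^k\,\varepsilon^*_i\varepsilon_\ell\varepsilon^*_j,\qquad 0=\sum_{\ell=0}^d{\theta^*_\ell}^k\,\varepsilon_i\varepsilon^*_\ell\varepsilon_j\qquad(0\le i,j\le d,\ 0\le k<|i-j|).$$ Regard $e^*_0Te^*_0$ and $\varepsilon^*_0\tilde T\varepsilon^*_0$ as $\mathbb F$-algebras with multiplicative identities $e^*_0$ and $\varepsilon^*_0$, and put $\tau_i=(x-\theta_0)(x-\theta_1)\cdots(x-\theta_{i-1})$. Then there exist unique $\mathbb F$-algebra homomorphisms $$\mu:\mathbb F[x_1,\dots,x_d]\to e^*_0Te^*_0,\quad x_i\mapsto e^*_0\tau_i(a)e^*_0\ (1\le i\le d),$$ $$\nu:\mathbb F[x_1,\dots,x_d]\to e^*_0Te^*_0,\quad x_i\mapsto e^*_0e_ie^*_0\ (1\le i\le d),$$ $$\tilde\nu:\mathbb F[x_0,\dots,x_d]\to\varepsilon^*_0\tilde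 T\varepsilon^*_0,\quad x_i\mapsto\varepsilon^*_0\varepsilon_i\varepsilon^*_0\ (0\le i\le d),$$ and: $\mu$ is an isomorphism if and only if $\nu$ is; $\nu$ is an isomorphism if and only if $\tilde\nu$ is; hence $\mu$ is an isomorphism if and only if $\tilde\nu$ is. -/

import Mathlib

open MvPolynomial

/-- The sequence `({θ_i}_{i=0}^d ; {θ*_i}_{i=0}^d)` of scalars in `F` is feasible: the `θ_i` are
mutually distinct, the `θ*_i` are mutually distinct, and the expressions
`(θ_{i-2} - θ_{i+1}) / (θ_{i-1} - θ_i)` and `(θ*_{i-2} - θ*_{i+1}) / (θ*_{i-1} - θ*_i)` are equal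
and independent of `i` for `2 ≤ i ≤ d - 1`. -/
structure Feasible {F : Type*} [Field F] {d : ℕ} (θ θs : Fin (d + 1) → F) : Prop where
  inj : Function.Injective θ
  inj_star : Function.Injective θs
  recur : ∃ c : F, ∀ (i : ℕ) (_ : 2 ≤ i) (_ : i + 1 ≤ d),
    (θ ⟨i - 2, by omega⟩ - θ ⟨i + 1, by omega⟩) / (θ ⟨i - 1, by omega⟩ - θ ⟨i, by omega⟩) = c ∧
    (θs ⟨i - 2, by omega⟩ - θs ⟨i + 1, by omega⟩) / (θs ⟨i - 1, by omega⟩ - θs ⟨i, by omega⟩) = c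

/-- `τ_i = (x - θ_0)(x - θ_1) ⋯ (x - θ_{i-1})` for `0 ≤ i ≤ d`. -/
noncomputable def tauPoly {F : Type*} [Field F] {d : ℕ} (θ : Fin (d + 1) → F)
    (i : Fin (d + 1)) : Polynomial F :=
  ∏ h ∈ Finset.univ.filter (fun h : Fin (d + 1) => h < i), (Polynomial.X - Polynomial.C (θ h))

/-- For an idempotent `e` of an `F`-algebra `A`, the corner `e A e`, a ring with identity `e`, is
an `F`-algebra under the scalar multiplication of `A`. -/
instance cornerSMul {F A : Type*} [CommSemiring F] [Semiring A] [Algebra F A] {e : A}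
    (idem : IsIdempotentElem e) : SMul F idem.Corner where
  smul r x := ⟨r • x.1, by
    obtain ⟨y, hy⟩ := x.2
    exact ⟨r • y, by rw [← hy]; simp [mul_assoc]⟩⟩

instance cornerModule {F A : Type*} [CommSemiring F] [Semiring A] [Algebra F A] {e : A}
    (idem : IsIdempotentElem e) : Module F idem.Corner where
  one_smul x := Subtype.ext (one_smul F x.1)
  mul_smul r s x := Subtype.ext (mul_smul r s x.1)
  smul_zero r := Subtype.ext (smul_zero (A := A) r)
  smul_add r x y := Subtype.ext (smul_add r x.1 y.1)
  add_smul r s x := Subtype.ext (add_smul r s x.1)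
  zero_smul x := Subtype.ext (zero_smul F x.1)

instance cornerAlgebra {F A : Type*} [CommSemiring F] [Semiring A] [Algebra F A] {e : A}
    (idem : IsIdempotentElem e) : Algebra F idem.Corner :=
  Algebra.ofModule (fun r x y => Subtype.ext (smul_mul_assoc r x.1 y.1))
    (fun r x y => Subtype.ext (mul_smul_comm r x.1 y.1))

/-- The element `e x e` of the corner `e A e`. -/
def toCorner {A : Type*} [Semiring A] {e : A} (idem : IsIdempotentElem e) (x : A) :
    idem.Corner :=
  ⟨e * x * e, x, rfl⟩

/-- The generators `a`, `e_i`, `a*`, `e*_i` (`0 ≤ i ≤ d`) of `T`. -/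
inductive TGen (d : ℕ) : Type
  | a : TGen d
  | e (i : Fin (d + 1)) : TGen d
  | as : TGen d
  | es (i : Fin (d + 1)) : TGen d

/-- The defining relations of `T`. -/
inductive TRel {F : Type*} [Field F] {d : ℕ} (θ θs : Fin (d + 1) → F) :
    FreeAlgebra F (TGen d) → FreeAlgebra F (TGen d) → Prop
  | e_mul (i j : Fin (d + 1)) : TRel θ θs
      (FreeAlgebra.ι F (TGen.e i) * FreeAlgebra.ι F (TGen.e j))
      (if i = j then FreeAlgebra.ι F (TGen.e i) else 0)
  | es_mul (i j : Fin (d + 1)) : TRel θ θs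
      (FreeAlgebra.ι F (TGen.es i) * FreeAlgebra.ι F (TGen.es j))
      (if i = j then FreeAlgebra.ι F (TGen.es i) else 0)
  | e_sum : TRel θ θs 1 (∑ i : Fin (d + 1), FreeAlgebra.ι F (TGen.e i))
  | es_sum : TRel θ θs 1 (∑ i : Fin (d + 1), FreeAlgebra.ι F (TGen.es i))
  | a_eq : TRel θ θs (FreeAlgebra.ι F TGen.a)
      (∑ i : Fin (d + 1), θ i • FreeAlgebra.ι F (TGen.e i))
  | as_eq : TRel θ θs (FreeAlgebra.ι F TGen.as)
      (∑ i : Fin (d + 1), θs i • FreeAlgebra.ι F (TGen.es i))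
  | es_a_es (i j : Fin (d + 1)) (k : ℕ) (hk : (k : ℤ) < |(i : ℤ) - (j : ℤ)|) : TRel θ θs
      (FreeAlgebra.ι F (TGen.es i) * FreeAlgebra.ι F TGen.a ^ k * FreeAlgebra.ι F (TGen.es j)) 0
  | e_as_e (i j : Fin (d + 1)) (k : ℕ) (hk : (k : ℤ) < |(i : ℤ) - (j : ℤ)|) : TRel θ θs
      (FreeAlgebra.ι F (TGen.e i) * FreeAlgebra.ι F TGen.as ^ k * FreeAlgebra.ι F (TGen.e j)) 0

/-- The `F`-algebra `T = T(p, F)`, for `p = (θ; θ*)`. -/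
abbrev TAlg {F : Type*} [Field F] {d : ℕ} (θ θs : Fin (d + 1) → F) : Type _ :=
  RingQuot (TRel θ θs)

/-- The image in `T` of a generator. -/
noncomputable def TAlg.gen {F : Type*} [Field F] {d : ℕ} (θ θs : Fin (d + 1) → F)
    (g : TGen d) : TAlg θ θs :=
  RingQuot.mkAlgHom F (TRel θ θs) (FreeAlgebra.ι F g)

/-- The generators `ε_i`, `ε*_i` (`0 ≤ i ≤ d`) of `T̃`. -/
inductive TtGen (d : ℕ) : Type
  | e (i : Fin (d + 1)) : TtGen d
  | es (i : Fin (d + 1)) : TtGen d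

/-- The defining relations of `T̃`. -/
inductive TtRel {F : Type*} [Field F] {d : ℕ} (θ θs : Fin (d + 1) → F) :
    FreeAlgebra F (TtGen d) → FreeAlgebra F (TtGen d) → Prop
  | e_mul (i j : Fin (d + 1)) : TtRel θ θs
      (FreeAlgebra.ι F (TtGen.e i) * FreeAlgebra.ι F (TtGen.e j))
      (if i = j then FreeAlgebra.ι F (TtGen.e i) else 0)
  | es_mul (i j : Fin (d + 1)) : TtRel θ θs
      (FreeAlgebra.ι F (TtGen.es i) * FreeAlgebra.ι F (TtGen.es j))
      (if i = j then FreeAlgebra.ι F (TtGen.es i) else 0)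
  | es_sum_es (i j : Fin (d + 1)) (k : ℕ) (hk : (k : ℤ) < |(i : ℤ) - (j : ℤ)|) : TtRel θ θs 0
      (∑ l : Fin (d + 1), θ l ^ k • (FreeAlgebra.ι F (TtGen.es i) *
        FreeAlgebra.ι F (TtGen.e l) * FreeAlgebra.ι F (TtGen.es j)))
  | e_sum_e (i j : Fin (d + 1)) (k : ℕ) (hk : (k : ℤ) < |(i : ℤ) - (j : ℤ)|) : TtRel θ θs 0
      (∑ l : Fin (d + 1), θs l ^ k • (FreeAlgebra.ι F (TtGen.e i) *
        FreeAlgebra.ι F (TtGen.es l) * FreeAlgebra.ι F (TtGen.e j)))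

/-- The `F`-algebra `T̃ = T̃(p, F)`, for `p = (θ; θ*)`. -/
abbrev TtAlg {F : Type*} [Field F] {d : ℕ} (θ θs : Fin (d + 1) → F) : Type _ :=
  RingQuot (TtRel θ θs)

/-- The image in `T̃` of a generator. -/
noncomputable def TtAlg.gen {F : Type*} [Field F] {d : ℕ} (θ θs : Fin (d + 1) → F)
    (g : TtGen d) : TtAlg θ θs :=
  RingQuot.mkAlgHom F (TtRel θ θs) (FreeAlgebra.ι F g)

theorem TAlg.idem {F : Type*} [Field F] {d : ℕ} (θ θs : Fin (d + 1) → F) :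
    IsIdempotentElem (TAlg.gen θ θs (TGen.es 0)) := by
  have h := RingQuot.mkAlgHom_rel F (TRel.es_mul (θ := θ) (θs := θs) 0 0)
  rwa [if_pos rfl, map_mul] at h

theorem TtAlg.idem {F : Type*} [Field F] {d : ℕ} (θ θs : Fin (d + 1) → F) :
    IsIdempotentElem (TtAlg.gen θ θs (TtGen.es 0)) := by
  have h := RingQuot.mkAlgHom_rel F (TtRel.es_mul (θ := θ) (θs := θs) 0 0)
  rwa [if_pos rfl, map_mul] at h

/-- The `F`-algebra `e*_0 T e*_0`, with identity `e*_0`. -/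
abbrev TCorner {F : Type*} [Field F] {d : ℕ} (θ θs : Fin (d + 1) → F) : Type _ :=
  (TAlg.idem θ θs).Corner

/-- The `F`-algebra `ε*_0 T̃ ε*_0`, with identity `ε*_0`. -/
abbrev TtCorner {F : Type*} [Field F] {d : ℕ} (θ θs : Fin (d + 1) → F) : Type _ :=
  (TtAlg.idem θ θs).Corner

/-- `μ : F[x_1, …, x_d] → e*_0 T e*_0` sends `x_i ↦ e*_0 τ_i(a) e*_0` for `1 ≤ i ≤ d`. The
indeterminate `x_{i+1}` is `X i` for `i : Fin d`, here and for `ν`. -/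
def IsMu {F : Type*} [Field F] {d : ℕ} (θ θs : Fin (d + 1) → F)
    (μ : MvPolynomial (Fin d) F →ₐ[F] TCorner θ θs) : Prop :=
  ∀ i : Fin d, μ (X i) =
    toCorner (TAlg.idem θ θs) (Polynomial.aeval (TAlg.gen θ θs TGen.a) (tauPoly θ i.succ))

/-- `ν : F[x_1, …, x_d] → e*_0 T e*_0` sends `x_i ↦ e*_0 e_i e*_0` for `1 ≤ i ≤ d`. -/
def IsNu {F : Type*} [Field F] {d : ℕ} (θ θs : Fin (d + 1) → F)
    (ν : MvPolynomial (Fin d) F →ₐ[F] TCorner θ θs) : Prop :=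
  ∀ i : Fin d, ν (X i) = toCorner (TAlg.idem θ θs) (TAlg.gen θ θs (TGen.e i.succ))

/-- `ν̃ : F[x_0, …, x_d] → ε*_0 T̃ ε*_0` sends `x_i ↦ ε*_0 ε_i ε*_0` for `0 ≤ i ≤ d`. -/
def IsNuTilde {F : Type*} [Field F] {d : ℕ} (θ θs : Fin (d + 1) → F)
    (νt : MvPolynomial (Fin (d + 1)) F →ₐ[F] TtCorner θ θs) : Prop :=
  ∀ i : Fin (d + 1), νt (X i) = toCorner (TtAlg.idem θ θs) (TtAlg.gen θ θs (TtGen.e i))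

-- In `T̃` write `u`, `v` for the sums of the `ε_i` and of the `ε*_i`, put `z = ε*_0` and `g_i = z
-- ε_i z`. Everything rests on elimination: if weighted sums against all polynomials of degree below
-- `n` vanish at distinct nodes, then `n` of the vectors are determined by the others
-- (`mem_of_sum_eval_smul_mem`). Applied to commutators, this makes the `g_i` commute
-- (`commute_corner`), so the three maps exist. Applied to words, it straightens every `z t z` into
-- `F z + ∑ g_i T̃` (`corner_mem`). The relations of `T̃` are homogeneous for the number of
-- alternations between the two families, and `g_i` has degree one. Induction on the degree then
-- shows that `ν̃` is surjective (`nuTilde_surjective`), and projecting to `T` gives the same for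
-- `ν`. Since `μ` and `ν` differ by the invertible triangular substitution with entries `τ_i(θ_j)`,
-- what remains is to compare the kernels of `ν` and `ν̃`. The projection `T̃ → T` turns `ν̃` into
-- `ν` composed with the dehomogenization `x_0 ↦ 1 - (x_1 + ⋯ + x_d)`. The kernel of `ν̃` is
-- homogeneous, and dehomogenization is injective on forms of a fixed degree, so injectivity passes
-- from `ν` to `ν̃`. Conversely, `s = 1 - (u - v)²` is central in `T̃`, and modulo `s - 1` the
-- corner at `v` satisfies the relations of `T`. Hence `ν f = 0` puts `ν̃ f` into the ideal of `s -
-- 1`. Cutting down by `z` exhibits `ν̃ f` as the image of a multiple of `∑ x_i - 1`; if `ν̃` is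
-- injective, dehomogenizing yields `f = 0`.

-- Elimination with polynomial weights

section Elimination

/-- If the weighted sums of the vectors `v i` against all polynomials of degree less than `n`
lie in `N`, and all but at most `n` of the `v i` lie in `N`, then all the `v i` lie in `N`. -/
theorem mem_of_sum_eval_smul_mem {F M ι : Type*} [Field F] [AddCommGroup M] [Module F M]
    [Fintype ι] [DecidableEq ι] (N : Submodule F M) {c : ι → F} (hc : Function.Injective c)
    (v : ι → M) (S : Finset ι) (n : ℕ) (hS : S.card ≤ n) (hv : ∀ i, i ∉ S → v i ∈ N)
    (h : ∀ p : Polynomial F, p.natDegree < n → ∑ i, p.eval (c i) • v i ∈ N) (i : ι) :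
    v i ∈ N := by
  by_cases hi : i ∈ S
  -- `p` vanishes at all nodes of `S` other than `c i`, so its weighted sum isolates `v i` modulo
  -- `N`.
  · let p : Polynomial F := ∏ m ∈ S.erase i, (Polynomial.X - Polynomial.C (c m))
    have hp : p.natDegree < n := by
      have h1 : p.natDegree = (S.erase i).card := by
        simp [p, Polynomial.natDegree_prod_of_monic _ _ (fun m _ => Polynomial.monic_X_sub_C (c m))]
      have h2 := Finset.card_erase_lt_of_mem hi
      omega
    have h0 := h p hp
    rw [← Finset.add_sum_erase _ _ (Finset.mem_univ i)] at h0
    have h1 : ∑ x ∈ Finset.univ.erase i, p.eval (c x) • v x ∈ N := by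
      refine N.sum_mem fun x hx => ?_
      by_cases hxS : x ∈ S
      · have : p.eval (c x) = 0 := by
          rw [Polynomial.eval_prod]
          exact Finset.prod_eq_zero (Finset.mem_erase.2 ⟨(Finset.mem_erase.1 hx).1, hxS⟩) (by simp)
        simp [this]
      · exact N.smul_mem _ (hv x hxS)
    have h2 : p.eval (c i) ≠ 0 := by
      rw [Polynomial.eval_prod, Finset.prod_ne_zero_iff]
      intro m hm
      simpa [sub_eq_zero] using fun h => (Finset.mem_erase.1 hm).1 (hc h).symm
    exact (N.smul_mem_iff h2).1 ((N.add_mem_iff_left h1).1 h0)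
  · exact hv i hi

theorem card_filter_fin_le {n : ℕ} (a b : ℕ) :
    (Finset.univ.filter (fun j : Fin n => a < (j : ℕ) ∧ (j : ℕ) ≤ b)).card ≤ b - a := by
  rw [← Nat.card_Ioc a b]
  refine Finset.card_le_card_of_injOn (fun j : Fin n => (j : ℕ)) ?_ (Fin.val_injective.injOn)
  intro j hj
  simpa using hj

/-- An array whose columns and rows satisfy the annihilation conditions for two flags of
polynomials, and which vanishes outside a square, vanishes. -/
theorem array_mem_of_flags {F M : Type*} [Field F] [AddCommGroup M] [Module F M] {d : ℕ}
    (N : Submodule F M) {θ θs : Fin (d + 1) → F} (hθ : Function.Injective θ)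
    (hθs : Function.Injective θs) (Y : Fin (d + 1) → Fin (d + 1) → M) (α b k : Fin (d + 1))
    (hbk : b ≤ k) (hlow : ∀ i j, i < α → Y i j ∈ N) (hhigh : ∀ i j, b < i → Y i j ∈ N)
    (hleft : ∀ i j, j ≤ α → Y i j ∈ N)
    (hcol : ∀ (j : Fin (d + 1)) (p : Polynomial F), (p.natDegree : ℤ) < |(α : ℤ) - (j : ℤ)| →
      ∑ i, p.eval (θ i) • Y i j ∈ N)
    (hrow : ∀ (i : Fin (d + 1)) (p : Polynomial F), (p.natDegree : ℤ) < |(i : ℤ) - (k : ℤ)| →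
      ∑ j, p.eval (θs j) • Y i j ∈ N) (i j : Fin (d + 1)) : Y i j ∈ N := by
  -- Rows are cleared upwards from `α` and columns downwards from `b`, in alternation. Each newly
  -- cleared row shortens the next column and conversely, so there are never more unknown entries
  -- than conditions.
  have key : ∀ m : ℕ, (∀ i j : Fin (d + 1), (i : ℕ) < α + m → Y i j ∈ N) ∧
      (∀ i j : Fin (d + 1), (b : ℕ) < j + m → Y i j ∈ N) := by
    intro m
    induction m with
    | zero =>
      refine ⟨fun i j h => hlow i j h, fun i j h => ?_⟩
      by_cases hα : j ≤ α
      · exact hleft i j hα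
      -- In a column `j > b` the unknown entries lie in rows `α` to `b`, row `α` included; since `b
      -- < j`, the `j - α` conditions suffice.
      refine mem_of_sum_eval_smul_mem N hθ (fun i => Y i j)
        (Finset.univ.filter (fun i => (α : ℕ) < (i : ℕ) ∧ (i : ℕ) ≤ b) ∪ {α}) (j - α) ?_ ?_ ?_ i
      · refine (Finset.card_union_le _ _).trans ?_
        have := card_filter_fin_le (n := d + 1) (α : ℕ) b
        rw [Finset.card_singleton]
        rw [Fin.le_def] at hα
        omega
      · intro i hi
        simp only [Finset.mem_union, Finset.mem_filter, Finset.mem_univ, true_and,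
          Finset.mem_singleton, Fin.ext_iff] at hi
        rcases lt_or_ge i α with h1 | h1
        · exact hlow i j h1
        · exact hhigh i j (by rw [Fin.le_def] at h1; rw [Fin.lt_def]; omega)
      · intro p hp
        refine hcol j p ?_
        rw [lt_abs]; omega
    | succ m ih =>
      have hr : ∀ i j : Fin (d + 1), (i : ℕ) < α + (m + 1) → Y i j ∈ N := by
        intro i j hi
        by_cases h1 : (i : ℕ) < α + m
        · exact ih.1 i j h1
        by_cases h2 : b < i
        · exact hhigh i j h2
        refine mem_of_sum_eval_smul_mem N hθs (fun j => Y i j)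
          (Finset.univ.filter (fun j => (α : ℕ) < (j : ℕ) ∧ (j : ℕ) ≤ b - m)) (k - i) ?_ ?_ ?_ j
        · refine (card_filter_fin_le (n := d + 1) (α : ℕ) (b - m)).trans ?_
          rw [Fin.le_def] at hbk
          omega
        · intro j hj
          simp only [Finset.mem_filter, Finset.mem_univ, true_and] at hj
          by_cases h3 : j ≤ α
          · exact hleft i j h3
          · refine ih.2 i j ?_
            rw [Fin.le_def] at h3
            omega
        · intro p hp
          refine hrow i p ?_
          rw [lt_abs]; omega
      refine ⟨hr, fun i j hj => ?_⟩
      by_cases h1 : (b : ℕ) < j + m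
      · exact ih.2 i j h1
      by_cases hα : j ≤ α
      · exact hleft i j hα
      refine mem_of_sum_eval_smul_mem N hθ (fun i => Y i j)
        (Finset.univ.filter (fun i => (α + m : ℕ) < (i : ℕ) ∧ (i : ℕ) ≤ b)) (j - α) ?_ ?_ ?_ i
      · refine (card_filter_fin_le (n := d + 1) (α + m : ℕ) b).trans ?_
        omega
      · intro i hi
        simp only [Finset.mem_filter, Finset.mem_univ, true_and] at hi
        by_cases h3 : b < i
        · exact hhigh i j h3
        · refine hr i j ?_
          rw [Fin.lt_def] at h3
          omega
      · intro p hp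
        refine hcol j p ?_
        rw [Fin.le_def] at hα
        rw [lt_abs]; omega
  exact (key (d + 1)).1 i j (by omega)

end Elimination

-- Idempotent systems and commutativity of the corner generators

/-- Two families of orthogonal idempotents that generate `A` and satisfy the defining relations
of `T̃`, stated for polynomials instead of powers. -/
structure IdempotentSystem {F A : Type*} [Field F] [Ring A] [Algebra F A] {d : ℕ}
    (x y : Fin (d + 1) → A) (θ θs : Fin (d + 1) → F) : Prop where
  inj : Function.Injective θ
  inj_star : Function.Injective θs
  x_mul : ∀ i j, x i * x j = if i = j then x i else 0
  y_mul : ∀ i j, y i * y j = if i = j then y i else 0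
  y_x_y : ∀ (i j : Fin (d + 1)) (p : Polynomial F), (p.natDegree : ℤ) < |(i : ℤ) - (j : ℤ)| →
    ∑ l, p.eval (θ l) • (y i * x l * y j) = 0
  x_y_x : ∀ (i j : Fin (d + 1)) (p : Polynomial F), (p.natDegree : ℤ) < |(i : ℤ) - (j : ℤ)| →
    ∑ l, p.eval (θs l) • (x i * y l * x j) = 0
  adjoin : Algebra.adjoin F (Set.range x ∪ Set.range y) = ⊤

namespace IdempotentSystem

variable {F A : Type*} [Field F] [Ring A] [Algebra F A] {d : ℕ}
  {x y : Fin (d + 1) → A} {θ θs : Fin (d + 1) → F}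

theorem swap (h : IdempotentSystem x y θ θs) : IdempotentSystem y x θs θ :=
  ⟨h.inj_star, h.inj, h.y_mul, h.x_mul, h.x_y_x, h.y_x_y, by rw [Set.union_comm]; exact h.adjoin⟩

theorem sum_rev_eval {M : Type*} [AddCommGroup M] [Module F M] (f : Fin (d + 1) → M)
    (p : Polynomial F) (c : Fin (d + 1) → F) :
    ∑ l : Fin (d + 1), p.eval (c l.rev) • f l.rev = ∑ l, p.eval (c l) • f l :=
  Equiv.sum_comp Fin.revPerm (fun l => p.eval (c l) • f l)

theorem rev (h : IdempotentSystem x y θ θs) :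
    IdempotentSystem (x ∘ Fin.rev) (y ∘ Fin.rev) (θ ∘ Fin.rev) (θs ∘ Fin.rev) where
  inj := h.inj.comp Fin.rev_injective
  inj_star := h.inj_star.comp Fin.rev_injective
  x_mul i j := by simp [h.x_mul]
  y_mul i j := by simp [h.y_mul]
  y_x_y i j p hp := by
    have := h.y_x_y i.rev j.rev p (by
      refine hp.trans_eq ?_
      rw [abs_sub_comm]; congr 1; simp only [Fin.val_rev]; omega)
    rw [← this]
    exact sum_rev_eval (fun l => y i.rev * x l * y j.rev) p θ
  x_y_x i j p hp := by
    have := h.x_y_x i.rev j.rev p (by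
      refine hp.trans_eq ?_
      rw [abs_sub_comm]; congr 1; simp only [Fin.val_rev]; omega)
    rw [← this]
    exact sum_rev_eval (fun l => x i.rev * y l * x j.rev) p θs
  adjoin := by
    rw [Fin.rev_surjective.range_comp, Fin.rev_surjective.range_comp]
    exact h.adjoin

/-- The elements `y_0 x_i y_0` mutually commute. -/
theorem commute_corner (h : IdempotentSystem x y θ θs) (i j : Fin (d + 1)) :
    (y 0 * x i * y 0) * (y 0 * x j * y 0) = (y 0 * x j * y 0) * (y 0 * x i * y 0) := by
  set w := y 0 with hw
  have hww : w * w = w := by simpa using h.y_mul 0 0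
  let C : Fin (d + 1) → Fin (d + 1) → A := fun i j =>
    (w * x i * w) * (w * x j * w) - (w * x j * w) * (w * x i * w)
  -- Induction on the number of vanishing moments of the commutators; `d + 1` moments force the
  -- commutators themselves to vanish.
  have key : ∀ k : ℕ, k ≤ d + 1 → ∀ p : Polynomial F, p.natDegree < k → ∀ j,
      ∑ i, p.eval (θ i) • C i j = 0 := by
    intro k
    induction k with
    | zero => intro _ p hp; omega
    | succ k ih =>
      intro hk
      replace ih := ih (by omega)
      let S : Finset (Fin (d + 1)) :=
        Finset.univ.filter (fun j => (0 : ℕ) < (j : ℕ) ∧ (j : ℕ) ≤ k)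
      -- `q` vanishes at `θs 1, …, θs k` but not at `θs 0`, and its degree is at most `k`, so
      -- `x_y_x` applies to indices more than `k` apart.
      let q : Polynomial F := ∏ m ∈ S, (Polynomial.X - Polynomial.C (θs m))
      have hq : q.natDegree ≤ k := by
        have h1 : q.natDegree = S.card := by
          simp [q, Polynomial.natDegree_prod_of_monic _ _
            (fun m _ => Polynomial.monic_X_sub_C (θs m))]
        have := card_filter_fin_le (n := d + 1) 0 k
        exact h1.trans_le this
      have hq0 : q.eval (θs 0) ≠ 0 := by
        rw [Polynomial.eval_prod, Finset.prod_ne_zero_iff]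
        intro m hm
        simp only [Polynomial.eval_sub, Polynomial.eval_X, Polynomial.eval_C, ne_eq, sub_eq_zero]
        intro h0
        have := h.inj_star h0
        subst this
        simp [S] at hm
      -- The middle factor `w` of each commutator is replaced by `∑ q(θs l) y l`.
      let Z : Fin (d + 1) → Fin (d + 1) → A := fun i j =>
        ∑ l, q.eval (θs l) • (w * x i * y l * x j * w - w * x j * y l * x i * w)
      have hZC : ∀ p : Polynomial F, p.natDegree < k + 1 → ∀ j,
          ∑ i, p.eval (θ i) • Z i j = q.eval (θs 0) • ∑ i, p.eval (θ i) • C i j := by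
        intro p hp j
        have h1 : ∑ i, p.eval (θ i) • Z i j = ∑ l, q.eval (θs l) •
            ∑ i, p.eval (θ i) • (w * x i * y l * x j * w - w * x j * y l * x i * w) := by
          simp only [Z, Finset.smul_sum]
          rw [Finset.sum_comm]
          exact Finset.sum_congr rfl fun l _ => Finset.sum_congr rfl fun i _ => smul_comm _ _ _
        -- Only `l = 0` survives: `q` kills `1 ≤ l ≤ k`, and for `l > k` the degree of `p` is below
        -- the distance from `y 0` to `y l`.
        rw [h1, Finset.sum_eq_single 0]
        · congr 1
          refine Finset.sum_congr rfl fun i _ => ?_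
          congr 1
          simp only [C, ← hw]
          congr 1
          · calc w * x i * w * x j * w = w * x i * (w * w) * x j * w := by rw [hww]
              _ = _ := by simp only [mul_assoc]
          · calc w * x j * w * x i * w = w * x j * (w * w) * x i * w := by rw [hww]
              _ = _ := by simp only [mul_assoc]
        · intro l _ hl
          by_cases hlk : (l : ℕ) ≤ k
          · have : q.eval (θs l) = 0 := by
              rw [Polynomial.eval_prod]
              refine Finset.prod_eq_zero (i := l) ?_ (by simp)
              simp only [S, Finset.mem_filter, Finset.mem_univ, true_and]
              exact ⟨Nat.pos_of_ne_zero fun h0 => hl (Fin.ext h0), hlk⟩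
            simp [this]
          · have h2 : ∑ i, p.eval (θ i) •
                (w * x i * y l * x j * w - w * x j * y l * x i * w) =
                (∑ i, p.eval (θ i) • (y 0 * x i * y l)) * x j * w -
                w * x j * ∑ i, p.eval (θ i) • (y l * x i * y 0) := by
              rw [Finset.mul_sum, Finset.sum_mul, Finset.sum_mul, ← Finset.sum_sub_distrib]
              refine Finset.sum_congr rfl fun i _ => ?_
              rw [smul_sub, smul_mul_assoc, smul_mul_assoc, mul_smul_comm, ← hw]
              simp only [mul_assoc]
            rw [h2, h.y_x_y, h.y_x_y]
            · simp
            · rw [lt_abs]; simp only [Fin.val_zero]; omega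
            · rw [lt_abs]; simp only [Fin.val_zero]; omega
        · simp
      have hanti : ∀ i j, Z i j = - Z j i := by
        intro i j
        simp only [Z, ← Finset.sum_neg_distrib, ← smul_neg, neg_sub]
      have hband : ∀ i j : Fin (d + 1), (i : ℕ) + k < j → Z i j = 0 := by
        intro i j hij
        have h2 : Z i j = w * (∑ l, q.eval (θs l) • (x i * y l * x j)) * w -
            w * (∑ l, q.eval (θs l) • (x j * y l * x i)) * w := by
          simp only [Z, Finset.mul_sum, Finset.sum_mul, ← Finset.sum_sub_distrib, smul_sub,
            smul_mul_assoc, mul_smul_comm, mul_assoc]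
        rw [h2, h.x_y_x, h.x_y_x]
        · simp
        · rw [lt_abs]; omega
        · rw [lt_abs]; omega
      -- Row by row: antisymmetry and the earlier rows dispose of `j ≤ i`, the band of `j > i + k`.
      -- At most `k` entries are left, against the `k` moments supplied by `ih`.
      have hZ0 : ∀ n : ℕ, ∀ i : Fin (d + 1), (i : ℕ) = n → ∀ j, Z i j = 0 := by
        intro n
        induction n using Nat.strong_induction_on with
        | _ n ihn =>
          intro i hi j
          have := mem_of_sum_eval_smul_mem (⊥ : Submodule F A) h.inj (fun j => Z i j)
            (Finset.univ.filter (fun j => (i : ℕ) < (j : ℕ) ∧ (j : ℕ) ≤ i + k)) k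
            ((card_filter_fin_le _ _).trans (by omega)) ?_ ?_ j
          · simpa using this
          · intro j hj
            simp only [Finset.mem_filter, Finset.mem_univ, true_and, not_and] at hj
            simp only [Submodule.mem_bot]
            rcases lt_trichotomy i j with h1 | h1 | h1
            · exact hband i j (by have := hj h1; omega)
            · subst h1; simp [Z]
            · rw [hanti, ihn j (by rw [← hi]; exact h1) j rfl, neg_zero]
          · intro p hp
            simp only [Submodule.mem_bot]
            have h3 := hZC p (by omega) i
            rw [ih p hp, smul_zero] at h3
            rw [← neg_eq_zero, ← h3, ← Finset.sum_neg_distrib]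
            exact Finset.sum_congr rfl fun l _ => by rw [hanti i l, smul_neg, neg_neg]
      intro p hp j
      have h4 := hZC p hp j
      rw [Finset.sum_eq_zero (fun i _ => by rw [hZ0 i i rfl, smul_zero])] at h4
      exact (smul_eq_zero.1 h4.symm).resolve_left hq0
  have := mem_of_sum_eval_smul_mem (⊥ : Submodule F A) h.inj (fun i => C i j) Finset.univ (d + 1)
    (by simp) (by simp) (fun p hp => by simpa using key (d + 1) le_rfl p hp j) i
  simpa [C, sub_eq_zero] using this

end IdempotentSystem

-- Straightening words in the corner

namespace IdempotentSystem

variable {F A : Type*} [Field F] [Ring A] [Algebra F A] {d : ℕ}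
  {x y : Fin (d + 1) → A} {θ θs : Fin (d + 1) → F}

/-- Every element `z * t` with `z = z * y α` is a combination of `z` and elements `z * x i * a`. -/
theorem exists_mul_eq (h : IdempotentSystem x y θ θs) {z : A} {α : Fin (d + 1)}
    (hz : z * y α = z) (t : A) :
    ∃ (c : F) (a : Fin (d + 1) → A), z * t = c • z + ∑ i, z * x i * a i := by
  have ht : t ∈ Algebra.adjoin F (Set.range x ∪ Set.range y) := by rw [h.adjoin]; trivial
  induction ht using Algebra.adjoin_induction with
  | mem t ht =>
    rcases ht with ⟨i, rfl⟩ | ⟨j, rfl⟩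
    · refine ⟨0, fun m => if m = i then 1 else 0, ?_⟩
      simp
    · refine ⟨if α = j then 1 else 0, 0, ?_⟩
      rw [← hz, mul_assoc, h.y_mul]
      split_ifs <;> simp
  | algebraMap r => exact ⟨r, 0, by simp [Algebra.smul_def, Algebra.commutes]⟩
  | add s t _ _ hs ht =>
    obtain ⟨c, a, hs⟩ := hs
    obtain ⟨c', a', ht⟩ := ht
    refine ⟨c + c', a + a', ?_⟩
    rw [mul_add, hs, ht]
    simp only [Pi.add_apply, mul_add, Finset.sum_add_distrib, add_smul]
    abel
  | mul s t _ _ hs ht =>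
    obtain ⟨c, a, hs⟩ := hs
    obtain ⟨c', a', ht⟩ := ht
    refine ⟨c * c', fun i => c • a' i + a i * t, ?_⟩
    rw [← mul_assoc, hs, add_mul, smul_mul_assoc, ht]
    simp only [smul_add, mul_add, Finset.sum_add_distrib, Finset.sum_mul, Finset.smul_sum,
      mul_smul_comm, mul_smul, mul_assoc, add_assoc]

/-- The right ideal `I` together with the element `z = z * y α` forms a straightening state with
bound `γ`: extending `z` by `x i` with `i` outside `[α, γ)`, or by any `x i` and then `y j` with
`j ≤ α`, leads into `I`. -/
structure StraighteningState (x y : Fin (d + 1) → A) (I : Submodule F A) (z : A)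
    (α : Fin (d + 1)) (γ : ℕ) : Prop where
  mul_mem : ∀ t ∈ I, ∀ a, t * a ∈ I
  mul_y : z * y α = z
  lower : ∀ i < α, z * x i ∈ I
  upper : ∀ i : Fin (d + 1), γ ≤ (i : ℕ) → z * x i ∈ I
  turn : ∀ i, ∀ j ≤ α, z * x i * y j ∈ I

/-- The right ideal generated by `I` and the elements `z * x i'` with `i < i'`. -/
def extendIdeal (x : Fin (d + 1) → A) (I : Submodule F A) (z : A) (i : Fin (d + 1)) :
    Submodule F A :=
  I ⊔ ⨆ i' : {i' : Fin (d + 1) // i < i'}, LinearMap.range (LinearMap.mulLeft F (z * x i'))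

theorem le_extendIdeal (I : Submodule F A) (z : A) (i : Fin (d + 1)) :
    I ≤ extendIdeal x I z i := le_sup_left

theorem mem_extendIdeal (I : Submodule F A) (z : A) {i i' : Fin (d + 1)} (hi : i < i') (a : A) :
    z * x i' * a ∈ extendIdeal x I z i :=
  le_sup_right (a := I) ((le_iSup (fun i' : {i' : Fin (d + 1) // i < i'} =>
    LinearMap.range (LinearMap.mulLeft F (z * x i'))) ⟨i', hi⟩) ⟨a, rfl⟩)

theorem extendIdeal_mul_mem {I J : Submodule F A} {z w : A} {i : Fin (d + 1)}
    (hI : ∀ t ∈ I, t * w ∈ J) (hJ : ∀ i', i < i' → ∀ a, z * x i' * a * w ∈ J) :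
    ∀ t ∈ extendIdeal x I z i, t * w ∈ J := by
  have : extendIdeal x I z i ≤ J.comap (LinearMap.mulRight F w) := by
    refine sup_le hI (iSup_le ?_)
    rintro ⟨i', hi'⟩ _ ⟨a, rfl⟩
    exact hJ i' hi' a
  exact this

namespace StraighteningState

/-- Appending a letter `x i` exchanges the two families and reverses their order, so a single notion
of state serves both kinds of letter. Modulo the continuations by later letters, the entries `z * x
i' * y j` have support short enough for elimination in `lower`, and the array `z * x i' * y j * x k`
is confined to the rows from `α` to `i` in `turn`. -/
theorem next (h : IdempotentSystem x y θ θs) {I : Submodule F A} {z : A} {α : Fin (d + 1)} {γ : ℕ}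
    (s : StraighteningState x y I z α γ) {i : Fin (d + 1)} (hi : α ≤ i) :
    StraighteningState (y ∘ Fin.rev) (x ∘ Fin.rev) (extendIdeal x I z i) (z * x i) i.rev
      (d - α) where
  mul_mem t ht a := by
    refine extendIdeal_mul_mem (fun t ht => le_extendIdeal I z i (s.mul_mem t ht a)) ?_ t ht
    intro i' hi' b
    rw [mul_assoc]
    exact mem_extendIdeal I z hi' _
  mul_y := by simp [mul_assoc, h.x_mul]
  lower j' hj' := by
    obtain ⟨j, rfl⟩ := Fin.rev_surjective j'
    rw [Fin.rev_lt_rev] at hj'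
    simp only [Function.comp_apply, Fin.rev_rev]
    refine mem_of_sum_eval_smul_mem (extendIdeal x I z i) h.inj (fun i => z * x i * y j)
      (Finset.univ.filter (fun i' => (α : ℕ) < (i' : ℕ) ∧ (i' : ℕ) ≤ j - 1) ∪ {α}) (j - α)
      ?_ ?_ ?_ i
    · refine (Finset.card_union_le _ _).trans ?_
      have := card_filter_fin_le (n := d + 1) (α : ℕ) (j - 1)
      rw [Finset.card_singleton]
      rw [Fin.le_def] at hi
      rw [Fin.lt_def] at hj'
      omega
    · intro i' hi'
      simp only [Finset.mem_union, Finset.mem_filter, Finset.mem_univ, true_and,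
        Finset.mem_singleton, Fin.ext_iff] at hi'
      rcases lt_or_ge i' α with h1 | h1
      · exact le_extendIdeal _ _ _ (s.mul_mem _ (s.lower i' h1) _)
      · refine mem_extendIdeal I z ?_ _
        rw [Fin.le_def] at h1
        rw [Fin.lt_def] at hj' ⊢
        omega
    · intro p hp
      have h1 := h.y_x_y α j p (by rw [lt_abs]; omega)
      have h2 : ∑ i, p.eval (θ i) • (z * x i * y j) =
          z * ∑ i, p.eval (θ i) • (y α * x i * y j) := by
        conv_lhs => rw [← s.mul_y]
        simp only [Finset.mul_sum, mul_smul_comm, mul_assoc]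
      rw [h2, h1, mul_zero]
      exact Submodule.zero_mem _
  upper j' hj' := by
    obtain ⟨j, rfl⟩ := Fin.rev_surjective j'
    simp only [Function.comp_apply, Fin.rev_rev]
    refine le_extendIdeal _ _ _ (s.turn i j ?_)
    rw [Fin.val_rev] at hj'
    rw [Fin.le_def]
    omega
  turn j' k' hk' := by
    obtain ⟨j, rfl⟩ := Fin.rev_surjective j'
    obtain ⟨k, rfl⟩ := Fin.rev_surjective k'
    rw [Fin.rev_le_rev] at hk'
    simp only [Function.comp_apply, Fin.rev_rev]
    refine array_mem_of_flags (extendIdeal x I z i) h.inj h.inj_star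
      (fun i j => z * x i * y j * x k) α i k hk' ?_ ?_ ?_ ?_ ?_ i j
    · intro i' j hi'
      exact le_extendIdeal _ _ _ (s.mul_mem _ (s.mul_mem _ (s.lower i' hi') _) _)
    · intro i' j hi'
      rw [mul_assoc]
      exact mem_extendIdeal I z hi' _
    · intro i' j hj
      exact le_extendIdeal _ _ _ (s.mul_mem _ (s.turn i' j hj) _)
    · intro j p hp
      have h1 := h.y_x_y α j p hp
      have h2 : ∑ i, p.eval (θ i) • (z * x i * y j * x k) =
          z * (∑ i, p.eval (θ i) • (y α * x i * y j)) * x k := by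
        conv_lhs => rw [← s.mul_y]
        simp only [Finset.mul_sum, Finset.sum_mul, mul_smul_comm, smul_mul_assoc, mul_assoc]
      rw [h2, h1, mul_zero, zero_mul]
      exact Submodule.zero_mem _
    · intro i' p hp
      have h1 := h.x_y_x i' k p hp
      have h2 : ∑ j, p.eval (θs j) • (z * x i' * y j * x k) =
          z * (∑ j, p.eval (θs j) • (x i' * y j * x k)) := by
        simp only [Finset.mul_sum, mul_smul_comm, mul_assoc]
      rw [h2, h1, mul_zero]
      exact Submodule.zero_mem _

/-- Induction on the gap `γ - α`, which shrinks under `next`. The two options for `w` are there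
because `next` turns `y 0` into the last element of the new first family, and the last `x` into the
zeroth element of the new second family. -/
theorem mul_mul_mem : ∀ (n : ℕ) {x y : Fin (d + 1) → A} {θ θs : Fin (d + 1) → F}
    (_ : IdempotentSystem x y θ θs) {I : Submodule F A} {z : A} {α : Fin (d + 1)} {γ : ℕ}
    (_ : StraighteningState x y I z α γ) (_ : γ - α ≤ n) {w : A}
    (_ : w = y 0 ∨ (w = x (Fin.last d) ∧ γ ≤ d)) (t : A),
    z * t * w ∈ I ⊔ Submodule.span F {z * w} := by
  intro n
  induction n with
  | zero =>
    intro x y θ θs h I z α γ s hn w hw t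
    obtain ⟨c, a, hza⟩ := h.exists_mul_eq s.mul_y t
    rw [hza, add_mul, smul_mul_assoc]
    refine add_mem (Submodule.mem_sup_right (Submodule.smul_mem _ _
      (Submodule.mem_span_singleton_self _))) (Submodule.mem_sup_left ?_)
    refine s.mul_mem _ (Submodule.sum_mem _ fun i _ => s.mul_mem _ ?_ _) _
    rcases lt_or_ge i α with h1 | h1
    · exact s.lower i h1
    · exact s.upper i (by rw [Fin.le_def] at h1; omega)
  | succ n ih =>
    intro x y θ θs h I z α γ s hn w hw t
    have hxw : ∀ i, z * x i * w ∈ I := by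
      intro i
      rcases hw with rfl | ⟨rfl, hγ⟩
      · exact s.turn i 0 (Fin.zero_le _)
      · rw [mul_assoc, h.x_mul]
        split_ifs with hi
        · subst hi
          exact s.upper _ (by simpa using hγ)
        · simp
    have hww : w * w = w := by
      rcases hw with rfl | ⟨rfl, _⟩
      · simp [h.y_mul]
      · simp [h.x_mul]
    -- Downward induction on `i`, since `extendIdeal x I z i` adds only continuations by letters `x
    -- i'` with `i' > i`.
    have key : ∀ m : ℕ, ∀ i : Fin (d + 1), d - (i : ℕ) ≤ m → ∀ a, z * x i * a * w ∈ I := by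
      intro m
      induction m using Nat.strong_induction_on with
      | _ m ihm =>
        intro i him a
        rcases lt_or_ge i α with h1 | h1
        · exact s.mul_mem _ (s.mul_mem _ (s.lower i h1) _) _
        by_cases h2 : γ ≤ (i : ℕ)
        · exact s.mul_mem _ (s.mul_mem _ (s.upper i h2) _) _
        rw [Fin.le_def] at h1
        -- The new gap is `(d - α) - (d - i) = i - α`, smaller than `γ - α`.
        have h3 := ih h.swap.rev (s.next h h1) (by rw [Fin.val_rev]; omega) (w := w)
          (by
            rcases hw with rfl | ⟨rfl, _⟩
            · right; simp
            · left; simp) a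
        have h4 : z * x i * a * w ∈ extendIdeal x I z i := by
          refine (sup_le le_rfl ?_ : extendIdeal x I z i ⊔ _ ≤ _) h3
          rw [Submodule.span_singleton_le_iff_mem]
          exact le_extendIdeal _ _ _ (hxw i)
        -- As `w` is idempotent, one more multiplication by `w` costs nothing, and it pushes the
        -- added generators into `I` by `ihm`.
        have h5 := extendIdeal_mul_mem (w := w) (J := I) (fun t ht => s.mul_mem t ht w)
          (fun i' hi' b => ihm (d - i') (by rw [Fin.lt_def] at hi'; omega) i' le_rfl b) _ h4
        rwa [mul_assoc, hww] at h5
    obtain ⟨c, a, hza⟩ := h.exists_mul_eq s.mul_y t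
    rw [hza, add_mul, smul_mul_assoc, Finset.sum_mul]
    exact add_mem (Submodule.mem_sup_right (Submodule.smul_mem _ _
      (Submodule.mem_span_singleton_self _))) (Submodule.mem_sup_left
      (Submodule.sum_mem _ fun i _ => key _ i le_rfl _))

end StraighteningState

/-- The corner at `y_0` is spanned by `y_0` and the elements `(y_0 x_i y_0) a`. -/
theorem corner_mem (h : IdempotentSystem x y θ θs) (t : A) :
    y 0 * t * y 0 ∈ (⨆ i, LinearMap.range (LinearMap.mulLeft F (y 0 * x i * y 0))) ⊔
      Submodule.span F {y 0} := by
  have hyy : y 0 * y 0 = y 0 := by simp [h.y_mul]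
  -- With bound `d + 1` the condition `upper` is vacuous, and with `α = 0` the condition `turn`
  -- concerns only `y 0`, where it holds by the choice of the ideal.
  have s : StraighteningState x y
      (⨆ i, LinearMap.range (LinearMap.mulLeft F (y 0 * x i * y 0))) (y 0) 0 (d + 1) := by
    refine ⟨fun t ht a => ?_, hyy, fun i hi => absurd hi (Fin.not_lt_zero i), fun i hi => ?_, ?_⟩
    · have : (⨆ i, LinearMap.range (LinearMap.mulLeft F (y 0 * x i * y 0))) ≤
          (⨆ i, LinearMap.range (LinearMap.mulLeft F (y 0 * x i * y 0))).comap
            (LinearMap.mulRight F a) := by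
        refine iSup_le fun i => ?_
        rintro _ ⟨b, rfl⟩
        refine (le_iSup (fun i => LinearMap.range (LinearMap.mulLeft F (y 0 * x i * y 0))) i)
          ⟨b * a, ?_⟩
        simp [mul_assoc]
      exact this ht
    · omega
    · intro i j hj
      obtain rfl : j = 0 := by simpa using hj
      exact (le_iSup (fun i => LinearMap.range (LinearMap.mulLeft F (y 0 * x i * y 0))) i)
          ⟨1, by simp [mul_assoc]⟩
  have := s.mul_mul_mem (d + 1) h (by simp) (Or.inl rfl) t
  rwa [hyy] at this

end IdempotentSystem

-- Presentations of `T̃` and `T`, and the projection between them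

section Presentation

variable {F : Type*} [Field F] {d : ℕ}

theorem sum_smul_pow {B : Type*} [Ring B] [Algebra F B] (θ : Fin (d + 1) → F)
    {e : Fin (d + 1) → B} (he : ∀ i j, e i * e j = if i = j then e i else 0)
    (hsum : ∑ i, e i = 1) (k : ℕ) : (∑ i, θ i • e i) ^ k = ∑ i, θ i ^ k • e i := by
  induction k with
  | zero => simp [hsum]
  | succ k ih =>
    rw [pow_succ, ih, Finset.sum_mul]
    refine Finset.sum_congr rfl fun i _ => ?_
    rw [Finset.mul_sum, Finset.sum_eq_single i]
    · rw [smul_mul_smul_comm, he, if_pos rfl, pow_succ]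
    · intro j _ hj
      rw [smul_mul_smul_comm, he, if_neg hj.symm, smul_zero]
    · simp

theorem aeval_sum_smul {B : Type*} [Ring B] [Algebra F B] (θ : Fin (d + 1) → F)
    {e : Fin (d + 1) → B} (he : ∀ i j, e i * e j = if i = j then e i else 0)
    (hsum : ∑ i, e i = 1) (p : Polynomial F) :
    Polynomial.aeval (∑ i, θ i • e i) p = ∑ i, p.eval (θ i) • e i := by
  induction p using Polynomial.induction_on' with
  | add p q hp hq => simp [hp, hq, add_smul, Finset.sum_add_distrib]
  | monomial n a =>
    rw [Polynomial.aeval_monomial, sum_smul_pow θ he hsum, ← Algebra.smul_def, Finset.smul_sum]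
    simp [mul_smul]

theorem sum_eval_smul_eq_zero {ι M : Type*} [Fintype ι] [AddCommGroup M] [Module F M]
    {c : ι → F} {v : ι → M} {n : ℤ} (h : ∀ k : ℕ, (k : ℤ) < n → ∑ l, c l ^ k • v l = 0)
    {p : Polynomial F} (hp : (p.natDegree : ℤ) < n) : ∑ l, p.eval (c l) • v l = 0 := by
  have h1 : ∀ l, p.eval (c l) • v l =
      ∑ k ∈ Finset.range (p.natDegree + 1), p.coeff k • c l ^ k • v l := by
    intro l
    rw [Polynomial.eval_eq_sum_range, Finset.sum_smul]
    simp only [mul_smul]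
  simp only [h1]
  rw [Finset.sum_comm]
  refine Finset.sum_eq_zero fun k hk => ?_
  rw [← Finset.smul_sum, h k, smul_zero]
  have := Finset.mem_range.1 hk
  omega

namespace TtAlg

variable (θ θs : Fin (d + 1) → F)

theorem e_mul (i j : Fin (d + 1)) : gen θ θs (.e i) * gen θ θs (.e j) =
    if i = j then gen θ θs (.e i) else 0 := by
  have h := RingQuot.mkAlgHom_rel F (TtRel.e_mul (θ := θ) (θs := θs) i j)
  rw [map_mul] at h
  refine h.trans ?_
  split_ifs
  · rfl
  · exact map_zero _

theorem es_mul (i j : Fin (d + 1)) : gen θ θs (.es i) * gen θ θs (.es j) =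
    if i = j then gen θ θs (.es i) else 0 := by
  have h := RingQuot.mkAlgHom_rel F (TtRel.es_mul (θ := θ) (θs := θs) i j)
  rw [map_mul] at h
  refine h.trans ?_
  split_ifs
  · rfl
  · exact map_zero _

theorem es_sum_es (i j : Fin (d + 1)) (k : ℕ) (hk : (k : ℤ) < |(i : ℤ) - (j : ℤ)|) :
    ∑ l, θ l ^ k • (gen θ θs (.es i) * gen θ θs (.e l) * gen θ θs (.es j)) = 0 := by
  have h := RingQuot.mkAlgHom_rel F (TtRel.es_sum_es (θ := θ) (θs := θs) i j k hk)
  simp only [map_zero, map_sum, map_smul, map_mul] at h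
  exact h.symm

theorem e_sum_e (i j : Fin (d + 1)) (k : ℕ) (hk : (k : ℤ) < |(i : ℤ) - (j : ℤ)|) :
    ∑ l, θs l ^ k • (gen θ θs (.e i) * gen θ θs (.es l) * gen θ θs (.e j)) = 0 := by
  have h := RingQuot.mkAlgHom_rel F (TtRel.e_sum_e (θ := θ) (θs := θs) i j k hk)
  simp only [map_zero, map_sum, map_smul, map_mul] at h
  exact h.symm

theorem adjoin_gen : Algebra.adjoin F
    (Set.range (fun i => gen θ θs (.e i)) ∪ Set.range (fun i => gen θ θs (.es i))) = ⊤ := by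
  have h1 : Set.range (fun i => gen θ θs (.e i)) ∪ Set.range (fun i => gen θ θs (.es i)) =
      RingQuot.mkAlgHom F (TtRel θ θs) '' Set.range (FreeAlgebra.ι F) := by
    ext t
    constructor
    · rintro (⟨i, rfl⟩ | ⟨i, rfl⟩)
      · exact ⟨_, ⟨_, rfl⟩, rfl⟩
      · exact ⟨_, ⟨_, rfl⟩, rfl⟩
    · rintro ⟨_, ⟨g, rfl⟩, rfl⟩
      cases g with
      | e i => exact Or.inl ⟨i, rfl⟩
      | es i => exact Or.inr ⟨i, rfl⟩
  rw [h1, ← AlgHom.map_adjoin, FreeAlgebra.adjoin_range_ι, Algebra.map_top]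
  exact AlgHom.range_eq_top _ |>.2 (RingQuot.mkAlgHom_surjective F _)

variable {θ θs} in
theorem idempotentSystem (hθ : Function.Injective θ) (hθs : Function.Injective θs) :
    IdempotentSystem (fun i => gen θ θs (.e i)) (fun i => gen θ θs (.es i)) θ θs where
  inj := hθ
  inj_star := hθs
  x_mul := e_mul θ θs
  y_mul := es_mul θ θs
  y_x_y i j _ hp := sum_eval_smul_eq_zero (es_sum_es θ θs i j) hp
  x_y_x i j _ hp := sum_eval_smul_eq_zero (e_sum_e θ θs i j) hp
  adjoin := adjoin_gen θ θs

theorem exists_lift {B : Type*} [Ring B] [Algebra F B] (e es : Fin (d + 1) → B)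
    (he : ∀ i j, e i * e j = if i = j then e i else 0)
    (hes : ∀ i j, es i * es j = if i = j then es i else 0)
    (h1 : ∀ (i j : Fin (d + 1)) (k : ℕ), (k : ℤ) < |(i : ℤ) - (j : ℤ)| →
      ∑ l, θ l ^ k • (es i * e l * es j) = 0)
    (h2 : ∀ (i j : Fin (d + 1)) (k : ℕ), (k : ℤ) < |(i : ℤ) - (j : ℤ)| →
      ∑ l, θs l ^ k • (e i * es l * e j) = 0) :
    ∃ φ : TtAlg θ θs →ₐ[F] B, (∀ i, φ (gen θ θs (.e i)) = e i) ∧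
      ∀ i, φ (gen θ θs (.es i)) = es i := by
  let f : TtGen d → B := fun g => match g with
    | .e i => e i
    | .es i => es i
  have hf : ∀ ⦃a b⦄, TtRel θ θs a b → FreeAlgebra.lift F f a = FreeAlgebra.lift F f b := by
    intro a b hab
    cases hab with
    | e_mul i j => rw [map_mul]; split_ifs with h <;> simp [f, he, h]
    | es_mul i j => rw [map_mul]; split_ifs with h <;> simp [f, hes, h]
    | es_sum_es i j k hk => simpa [f] using (h1 i j k hk).symm
    | e_sum_e i j k hk => simpa [f] using (h2 i j k hk).symm
  refine ⟨RingQuot.liftAlgHom F ⟨FreeAlgebra.lift F f, hf⟩, fun i => ?_, fun i => ?_⟩ <;>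
  · rw [gen, RingQuot.liftAlgHom_mkAlgHom_apply, FreeAlgebra.lift_ι_apply]

end TtAlg

namespace TAlg

variable (θ θs : Fin (d + 1) → F)

theorem e_mul (i j : Fin (d + 1)) : gen θ θs (.e i) * gen θ θs (.e j) =
    if i = j then gen θ θs (.e i) else 0 := by
  have h := RingQuot.mkAlgHom_rel F (TRel.e_mul (θ := θ) (θs := θs) i j)
  rw [map_mul] at h
  refine h.trans ?_
  split_ifs
  · rfl
  · exact map_zero _

theorem es_mul (i j : Fin (d + 1)) : gen θ θs (.es i) * gen θ θs (.es j) =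
    if i = j then gen θ θs (.es i) else 0 := by
  have h := RingQuot.mkAlgHom_rel F (TRel.es_mul (θ := θ) (θs := θs) i j)
  rw [map_mul] at h
  refine h.trans ?_
  split_ifs
  · rfl
  · exact map_zero _

theorem e_sum : ∑ i, gen θ θs (.e i) = 1 := by
  have h := RingQuot.mkAlgHom_rel F (TRel.e_sum (θ := θ) (θs := θs))
  rw [map_one, map_sum] at h
  exact h.symm

theorem es_sum : ∑ i, gen θ θs (.es i) = 1 := by
  have h := RingQuot.mkAlgHom_rel F (TRel.es_sum (θ := θ) (θs := θs))
  rw [map_one, map_sum] at h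
  exact h.symm

theorem a_eq : gen θ θs .a = ∑ i, θ i • gen θ θs (.e i) := by
  have h := RingQuot.mkAlgHom_rel F (TRel.a_eq (θ := θ) (θs := θs))
  simp only [map_sum, map_smul] at h
  exact h

theorem as_eq : gen θ θs .as = ∑ i, θs i • gen θ θs (.es i) := by
  have h := RingQuot.mkAlgHom_rel F (TRel.as_eq (θ := θ) (θs := θs))
  simp only [map_sum, map_smul] at h
  exact h

theorem es_sum_es (i j : Fin (d + 1)) (k : ℕ) (hk : (k : ℤ) < |(i : ℤ) - (j : ℤ)|) :
    ∑ l, θ l ^ k • (gen θ θs (.es i) * gen θ θs (.e l) * gen θ θs (.es j)) = 0 := by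
  have h := RingQuot.mkAlgHom_rel F (TRel.es_a_es (θ := θ) (θs := θs) i j k hk)
  rw [map_zero, map_mul, map_mul, map_pow] at h
  have h' : gen θ θs (.es i) * gen θ θs .a ^ k * gen θ θs (.es j) = 0 := h
  rw [a_eq, sum_smul_pow θ (e_mul θ θs) (e_sum θ θs)] at h'
  simpa [Finset.mul_sum, Finset.sum_mul] using h'

theorem e_sum_e (i j : Fin (d + 1)) (k : ℕ) (hk : (k : ℤ) < |(i : ℤ) - (j : ℤ)|) :
    ∑ l, θs l ^ k • (gen θ θs (.e i) * gen θ θs (.es l) * gen θ θs (.e j)) = 0 := by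
  have h := RingQuot.mkAlgHom_rel F (TRel.e_as_e (θ := θ) (θs := θs) i j k hk)
  rw [map_zero, map_mul, map_mul, map_pow] at h
  have h' : gen θ θs (.e i) * gen θ θs .as ^ k * gen θ θs (.e j) = 0 := h
  rw [as_eq, sum_smul_pow θs (es_mul θ θs) (es_sum θ θs)] at h'
  simpa [Finset.mul_sum, Finset.sum_mul] using h'

theorem exists_lift {B : Type*} [Ring B] [Algebra F B] (e es : Fin (d + 1) → B)
    (he : ∀ i j, e i * e j = if i = j then e i else 0)
    (hes : ∀ i j, es i * es j = if i = j then es i else 0)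
    (hsum : ∑ i, e i = 1) (hsums : ∑ i, es i = 1)
    (h1 : ∀ (i j : Fin (d + 1)) (k : ℕ), (k : ℤ) < |(i : ℤ) - (j : ℤ)| →
      ∑ l, θ l ^ k • (es i * e l * es j) = 0)
    (h2 : ∀ (i j : Fin (d + 1)) (k : ℕ), (k : ℤ) < |(i : ℤ) - (j : ℤ)| →
      ∑ l, θs l ^ k • (e i * es l * e j) = 0) :
    ∃ φ : TAlg θ θs →ₐ[F] B, (∀ i, φ (gen θ θs (.e i)) = e i) ∧
      ∀ i, φ (gen θ θs (.es i)) = es i := by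
  let f : TGen d → B := fun g => match g with
    | .a => ∑ i, θ i • e i
    | .e i => e i
    | .as => ∑ i, θs i • es i
    | .es i => es i
  have hf : ∀ ⦃a b⦄, TRel θ θs a b → FreeAlgebra.lift F f a = FreeAlgebra.lift F f b := by
    intro a b hab
    cases hab with
    | e_mul i j => rw [map_mul]; split_ifs with h <;> simp [f, he, h]
    | es_mul i j => rw [map_mul]; split_ifs with h <;> simp [f, hes, h]
    | e_sum => simp [f, hsum]
    | es_sum => simp [f, hsums]
    | a_eq => simp [f]
    | as_eq => simp [f]
    | es_a_es i j k hk =>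
      have := h1 i j k hk
      simp only [map_mul, map_pow, FreeAlgebra.lift_ι_apply, map_zero, f]
      rw [sum_smul_pow θ he hsum]
      simpa [Finset.mul_sum, Finset.sum_mul] using this
    | e_as_e i j k hk =>
      have := h2 i j k hk
      simp only [map_mul, map_pow, FreeAlgebra.lift_ι_apply, map_zero, f]
      rw [sum_smul_pow θs hes hsums]
      simpa [Finset.mul_sum, Finset.sum_mul] using this
  refine ⟨RingQuot.liftAlgHom F ⟨FreeAlgebra.lift F f, hf⟩, fun i => ?_, fun i => ?_⟩ <;>
  · rw [gen, RingQuot.liftAlgHom_mkAlgHom_apply, FreeAlgebra.lift_ι_apply]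

/-- The canonical surjection `T̃ → T`. -/
theorem exists_projection : ∃ π : TtAlg θ θs →ₐ[F] TAlg θ θs,
    (∀ i, π (TtAlg.gen θ θs (.e i)) = gen θ θs (.e i)) ∧
    (∀ i, π (TtAlg.gen θ θs (.es i)) = gen θ θs (.es i)) ∧ Function.Surjective π := by
  obtain ⟨π, he, hes⟩ := TtAlg.exists_lift θ θs (fun i => gen θ θs (.e i))
    (fun i => gen θ θs (.es i)) (e_mul θ θs) (es_mul θ θs) (es_sum_es θ θs) (e_sum_e θ θs)
  refine ⟨π, he, hes, ?_⟩
  have hgen : ∀ g, gen θ θs g ∈ π.range := by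
    intro g
    cases g with
    | a => rw [a_eq]; exact sum_mem fun i _ => π.range.smul_mem ⟨_, he i⟩ _
    | as => rw [as_eq]; exact sum_mem fun i _ => π.range.smul_mem ⟨_, hes i⟩ _
    | e i => exact ⟨_, he i⟩
    | es i => exact ⟨_, hes i⟩
  rw [← AlgHom.range_eq_top, eq_top_iff]
  have h1 : (⊤ : Subalgebra F (TAlg θ θs)) =
      Algebra.adjoin F (RingQuot.mkAlgHom F (TRel θ θs) '' Set.range (FreeAlgebra.ι F)) := by
    rw [← AlgHom.map_adjoin, FreeAlgebra.adjoin_range_ι, Algebra.map_top]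
    exact ((AlgHom.range_eq_top _).2 (RingQuot.mkAlgHom_surjective F _)).symm
  rw [h1]
  refine Algebra.adjoin_le ?_
  rintro _ ⟨_, ⟨g, rfl⟩, rfl⟩
  exact hgen g

end TAlg

end Presentation

-- Corner algebras and evaluation at commuting elements

section Corner

variable {F : Type*} [Field F] {A B : Type*} [Ring A] [Algebra F A] [Ring B] [Algebra F B]

/-- The inclusion of a corner as a linear map. -/
def cornerVal {e : A} (idem : IsIdempotentElem e) : idem.Corner →ₗ[F] A where
  toFun x := x.1
  map_add' _ _ := rfl
  map_smul' _ _ := rfl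

theorem cornerVal_injective {e : A} (idem : IsIdempotentElem e) :
    Function.Injective (cornerVal (F := F) idem) := Subtype.val_injective

theorem cornerVal_mul {e : A} (idem : IsIdempotentElem e) (x y : idem.Corner) :
    cornerVal (F := F) idem (x * y) = cornerVal (F := F) idem x * cornerVal (F := F) idem y := rfl

theorem cornerVal_one {e : A} (idem : IsIdempotentElem e) :
    cornerVal (F := F) idem 1 = e := rfl

theorem cornerVal_toCorner {e : A} (idem : IsIdempotentElem e) (x : A) :
    cornerVal (F := F) idem (toCorner idem x) = e * x * e := rfl

theorem mul_cornerVal_mul {e : A} (idem : IsIdempotentElem e) (x : idem.Corner) :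
    e * cornerVal (F := F) idem x * e = cornerVal (F := F) idem x := by
  obtain ⟨_, y, rfl⟩ := x
  simp only [cornerVal, LinearMap.coe_mk]
  have h : e * e = e := idem
  calc e * (e * y * e) * e = (e * e) * y * (e * e) := by simp only [mul_assoc]
    _ = e * y * e := by rw [h]

theorem exists_toCorner {e : A} (idem : IsIdempotentElem e) (x : idem.Corner) :
    ∃ t, x = toCorner idem t := by
  obtain ⟨_, y, rfl⟩ := x
  exact ⟨y, rfl⟩

/-- An algebra map restricts to the corners at corresponding idempotents. -/
def cornerMap (φ : A →ₐ[F] B) {e : A} (idem : IsIdempotentElem e) {e' : B}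
    (idem' : IsIdempotentElem e') (h : φ e = e') : idem.Corner →ₐ[F] idem'.Corner :=
  AlgHom.ofLinearMap
    { toFun := fun x => ⟨φ x.1, by
        obtain ⟨_, y, rfl⟩ := x
        exact ⟨φ y, by simp [h]⟩⟩
      map_add' := fun x y => Subtype.ext (map_add φ x.1 y.1)
      map_smul' := fun r x => Subtype.ext (map_smul φ r x.1) }
    (Subtype.ext h) (fun x y => Subtype.ext (map_mul φ x.1 y.1))

theorem cornerVal_cornerMap (φ : A →ₐ[F] B) {e : A} (idem : IsIdempotentElem e) {e' : B}
    (idem' : IsIdempotentElem e') (h : φ e = e') (x : idem.Corner) :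
    cornerVal (F := F) idem' (cornerMap φ idem idem' h x) = φ (cornerVal (F := F) idem x) := rfl

-- The target need not be commutative, so evaluation passes through the commutative subalgebra
-- generated by the `c i`.
open scoped IsMulCommutative in
theorem exists_mvPolynomial_algHom {A ι : Type*} [Semiring A] [Algebra F A]
    (c : ι → A)
    (hc : ∀ i j, c i * c j = c j * c i) :
    ∃ g : MvPolynomial ι F →ₐ[F] A, ∀ i, g (X i) = c i := by
  have := Algebra.isMulCommutative_adjoin F (s := Set.range c) (by
    rintro _ ⟨i, rfl⟩ _ ⟨j, rfl⟩
    exact hc i j)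
  refine ⟨(Algebra.adjoin F (Set.range c)).val.comp
    (MvPolynomial.aeval (S₁ := Algebra.adjoin F (Set.range c))
      fun i => ⟨c i, Algebra.subset_adjoin ⟨i, rfl⟩⟩), fun i => ?_⟩
  simp

theorem existsUnique_mvPolynomial_algHom {A ι : Type*} [Semiring A] [Algebra F A]
    (c : ι → A)
    (hc : ∀ i j, c i * c j = c j * c i) :
    ∃! g : MvPolynomial ι F →ₐ[F] A, ∀ i, g (X i) = c i := by
  obtain ⟨g, hg⟩ := exists_mvPolynomial_algHom (F := F) c hc
  exact ⟨g, hg, fun g' hg' => MvPolynomial.algHom_ext fun i => (hg' i).trans (hg i).symm⟩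

end Corner

-- The grading by alternations and surjectivity of `ν̃`

section Grading

open scoped TensorProduct

variable {F : Type*} [Field F]

/-- The idempotent `diag(1, 0)`. -/
noncomputable def gradQ (F : Type*) [Field F] : Matrix (Fin 2) (Fin 2) (Polynomial F) :=
  !![1, 0; 0, 0]

/-- An idempotent `P` with `Q P Q = t Q` for `Q = diag(1, 0)`. -/
noncomputable def gradP (F : Type*) [Field F] : Matrix (Fin 2) (Fin 2) (Polynomial F) :=
  !![Polynomial.X, Polynomial.X * (1 - Polynomial.X); 1, 1 - Polynomial.X]

theorem gradQ_mul_self : gradQ F * gradQ F = gradQ F := by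
  ext i j
  fin_cases i <;> fin_cases j <;> simp [gradQ, Matrix.mul_apply]

theorem gradP_mul_self : gradP F * gradP F = gradP F := by
  ext1 i j
  fin_cases i <;> fin_cases j <;> simp [gradP, Matrix.mul_apply] <;> ring

theorem gradQ_gradP_gradQ :
    gradQ F * gradP F * gradQ F = (Polynomial.X : Polynomial F) • gradQ F := by
  ext1 i j
  fin_cases i <;> fin_cases j <;> simp [gradP, gradQ, Matrix.mul_apply]

variable (F) (A : Type*) [Ring A] [Algebra F A]

/-- The map `p ⊗ a ↦ c a`, where `c` is the coefficient of `t ^ n` in the corner entry of `p`. -/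
noncomputable def gradCoeff (n : ℕ) : Matrix (Fin 2) (Fin 2) (Polynomial F) ⊗[F] A →ₗ[F] A :=
  TensorProduct.lift (LinearMap.lsmul F A ∘ₗ
    (Polynomial.lcoeff F n ∘ₗ Matrix.entryLinearMap F (Polynomial F) 0 0))

/-- The map `p ⊗ a ↦ c a`, where `c` is the value at `1` of the corner entry of `p`. -/
noncomputable def gradEval : Matrix (Fin 2) (Fin 2) (Polynomial F) ⊗[F] A →ₗ[F] A :=
  TensorProduct.lift (LinearMap.lsmul F A ∘ₗ
    (Polynomial.leval 1 ∘ₗ Matrix.entryLinearMap F (Polynomial F) 0 0))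

variable {F A}

theorem gradCoeff_tmul (n : ℕ) (p : Matrix (Fin 2) (Fin 2) (Polynomial F)) (a : A) :
    gradCoeff F A n (p ⊗ₜ a) = (p 0 0).coeff n • a := by
  simp [gradCoeff]

theorem gradEval_tmul (p : Matrix (Fin 2) (Fin 2) (Polynomial F)) (a : A) :
    gradEval F A (p ⊗ₜ a) = (p 0 0).eval 1 • a := by
  simp [gradEval, Polynomial.leval]

/-- The value of a polynomial at `1` is the finite sum of its coefficients. -/
theorem gradEval_mem (S : Submodule F A) (m : Matrix (Fin 2) (Fin 2) (Polynomial F) ⊗[F] A)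
    (h : ∀ n, gradCoeff F A n m ∈ S) : gradEval F A m ∈ S := by
  have key : ∃ N, ∀ n ≥ N, gradEval F A m = ∑ k ∈ Finset.range n, gradCoeff F A k m := by
    clear h
    induction m using TensorProduct.induction_on with
    | zero => exact ⟨0, by simp⟩
    | tmul p a =>
      refine ⟨(p 0 0).natDegree + 1, fun n hn => ?_⟩
      rw [gradEval_tmul, Polynomial.eval_eq_sum_range' (n := n) (by omega), Finset.sum_smul]
      simp [gradCoeff_tmul]
    | add m m' hm hm' =>
      obtain ⟨N, hN⟩ := hm
      obtain ⟨N', hN'⟩ := hm'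
      refine ⟨max N N', fun n hn => ?_⟩
      rw [map_add, hN n ((le_max_left _ _).trans hn), hN' n ((le_max_right _ _).trans hn)]
      simp only [map_add, Finset.sum_add_distrib]
  obtain ⟨N, hN⟩ := key
  rw [hN N le_rfl]
  exact S.sum_mem fun k _ => h k

theorem gradCoeff_zero_mul (b : A) (m : Matrix (Fin 2) (Fin 2) (Polynomial F) ⊗[F] A) :
    gradCoeff F A 0 (((Polynomial.X : Polynomial F) • gradQ F) ⊗ₜ[F] b * m) = 0 := by
  induction m using TensorProduct.induction_on with
  | zero => simp
  | tmul p a =>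
    rw [Algebra.TensorProduct.tmul_mul_tmul, gradCoeff_tmul]
    simp [gradQ, Matrix.mul_apply]
  | add m m' hm hm' => rw [mul_add, map_add, hm, hm', add_zero]

theorem gradCoeff_succ_mul (n : ℕ) (b : A) (m : Matrix (Fin 2) (Fin 2) (Polynomial F) ⊗[F] A) :
    gradCoeff F A (n + 1) (((Polynomial.X : Polynomial F) • gradQ F) ⊗ₜ[F] b * m) =
      b * gradCoeff F A n m := by
  induction m using TensorProduct.induction_on with
  | zero => simp
  | tmul p a =>
    rw [Algebra.TensorProduct.tmul_mul_tmul, gradCoeff_tmul, gradCoeff_tmul]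
    simp [gradQ, Matrix.mul_apply]
  | add m m' hm hm' => rw [mul_add, map_add, hm, hm', map_add, mul_add]

theorem gradEval_gradQ_mul (b : A) (m : Matrix (Fin 2) (Fin 2) (Polynomial F) ⊗[F] A) :
    gradEval F A (gradQ F ⊗ₜ[F] b * m) = b * gradEval F A m := by
  induction m using TensorProduct.induction_on with
  | zero => simp
  | tmul p a =>
    rw [Algebra.TensorProduct.tmul_mul_tmul, gradEval_tmul, gradEval_tmul]
    simp [gradQ, Matrix.mul_apply]
  | add m m' hm hm' => rw [mul_add, map_add, hm, hm', map_add, mul_add]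

theorem gradEval_gradP_mul (b : A) (m : Matrix (Fin 2) (Fin 2) (Polynomial F) ⊗[F] A) :
    gradEval F A (gradP F ⊗ₜ[F] b * m) = b * gradEval F A m := by
  induction m using TensorProduct.induction_on with
  | zero => simp
  | tmul p a =>
    rw [Algebra.TensorProduct.tmul_mul_tmul, gradEval_tmul, gradEval_tmul]
    simp [gradP, Matrix.mul_apply]
  | add m m' hm hm' => rw [mul_add, map_add, hm, hm', map_add, mul_add]

namespace TtAlg

variable {d : ℕ} (θ θs : Fin (d + 1) → F)

/-- The grading of `T̃` by the number of alternations, as an algebra map. -/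
theorem exists_grading :
    ∃ Δ : TtAlg θ θs →ₐ[F] Matrix (Fin 2) (Fin 2) (Polynomial F) ⊗[F] TtAlg θ θs,
      (∀ i, Δ (gen θ θs (.e i)) = gradP F ⊗ₜ gen θ θs (.e i)) ∧
      ∀ i, Δ (gen θ θs (.es i)) = gradQ F ⊗ₜ gen θ θs (.es i) := by
  refine exists_lift θ θs (fun i => gradP F ⊗ₜ[F] gen θ θs (.e i))
    (fun i => gradQ F ⊗ₜ[F] gen θ θs (.es i)) ?_ ?_ ?_ ?_
  · intro i j
    rw [Algebra.TensorProduct.tmul_mul_tmul, gradP_mul_self, e_mul]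
    split_ifs <;> simp
  · intro i j
    rw [Algebra.TensorProduct.tmul_mul_tmul, gradQ_mul_self, es_mul]
    split_ifs <;> simp
  · intro i j k hk
    simp only [Algebra.TensorProduct.tmul_mul_tmul, ← TensorProduct.tmul_smul,
      ← TensorProduct.tmul_sum]
    rw [es_sum_es θ θs i j k hk, TensorProduct.tmul_zero]
  · intro i j k hk
    simp only [Algebra.TensorProduct.tmul_mul_tmul, ← TensorProduct.tmul_smul,
      ← TensorProduct.tmul_sum]
    rw [e_sum_e θ θs i j k hk, TensorProduct.tmul_zero]

variable {θ θs}

variable {Δ : TtAlg θ θs →ₐ[F] Matrix (Fin 2) (Fin 2) (Polynomial F) ⊗[F] TtAlg θ θs}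

/-- At `t = 1` the first row of both `gradP` and `gradQ` is `(1, 0)`, so multiplying by `Δ t` and
then evaluating the corner entry amounts to multiplying by `t`. An element is thereby recovered from
its graded pieces. -/
theorem gradEval_grading (he : ∀ i, Δ (gen θ θs (.e i)) = gradP F ⊗ₜ gen θ θs (.e i))
    (hes : ∀ i, Δ (gen θ θs (.es i)) = gradQ F ⊗ₜ gen θ θs (.es i))
    (t : TtAlg θ θs) : gradEval F (TtAlg θ θs) (Δ t) = t := by
  -- `gradEval` is not multiplicative; the free factor `m` lets the induction pass through products.
  have key : ∀ m, gradEval F (TtAlg θ θs) (Δ t * m) = t * gradEval F (TtAlg θ θs) m := by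
    have ht : t ∈ Algebra.adjoin F
      (Set.range (fun i => gen θ θs (.e i)) ∪ Set.range (fun i => gen θ θs (.es i))) := by
      rw [adjoin_gen]; trivial
    induction ht using Algebra.adjoin_induction with
    | mem t ht =>
      rcases ht with ⟨i, rfl⟩ | ⟨i, rfl⟩
      · intro m; simp only [he]; exact gradEval_gradP_mul _ m
      · intro m; simp only [hes]; exact gradEval_gradQ_mul _ m
    | algebraMap r => intro m; rw [AlgHom.commutes, ← Algebra.smul_def, map_smul, Algebra.smul_def]
    | add s t _ _ hs ht => intro m; rw [map_add, add_mul, map_add, hs, ht, add_mul]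
    | mul s t _ _ hs ht => intro m; rw [map_mul Δ, mul_assoc, hs, ht, mul_assoc]
  have h1 : gradEval F (TtAlg θ θs) 1 = 1 := by
    rw [Algebra.TensorProduct.one_def, gradEval_tmul]
    simp
  simpa [h1] using key 1

theorem grading_corner (he : ∀ i, Δ (gen θ θs (.e i)) = gradP F ⊗ₜ gen θ θs (.e i))
    (hes : ∀ i, Δ (gen θ θs (.es i)) = gradQ F ⊗ₜ gen θ θs (.es i))
    (i : Fin (d + 1)) :
    Δ (gen θ θs (.es 0) * gen θ θs (.e i) * gen θ θs (.es 0)) =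
      ((Polynomial.X : Polynomial F) • gradQ F) ⊗ₜ[F]
        (gen θ θs (.es 0) * gen θ θs (.e i) * gen θ θs (.es 0)) := by
  rw [map_mul, map_mul, he, hes, Algebra.TensorProduct.tmul_mul_tmul,
    Algebra.TensorProduct.tmul_mul_tmul, gradQ_gradP_gradQ]

theorem gradCoeff_grading_one
    (hes : ∀ i, Δ (gen θ θs (.es i)) = gradQ F ⊗ₜ gen θ θs (.es i)) (n : ℕ) :
    gradCoeff F (TtAlg θ θs) n (Δ (gen θ θs (.es 0))) =
      if n = 0 then gen θ θs (.es 0) else 0 := by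
  rw [hes, gradCoeff_tmul]
  simp [gradQ, Polynomial.coeff_one]

/-- The map `ν̃` respects the grading. -/
theorem gradCoeff_nuTilde (he : ∀ i, Δ (gen θ θs (.e i)) = gradP F ⊗ₜ gen θ θs (.e i))
    (hes : ∀ i, Δ (gen θ θs (.es i)) = gradQ F ⊗ₜ gen θ θs (.es i))
    {νt : MvPolynomial (Fin (d + 1)) F →ₐ[F] TtCorner θ θs}
    (hν : IsNuTilde θ θs νt) (n : ℕ) (f : MvPolynomial (Fin (d + 1)) F) :
    gradCoeff F (TtAlg θ θs) n (Δ (cornerVal (F := F) (TtAlg.idem θ θs) (νt f))) =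
      cornerVal (F := F) (TtAlg.idem θ θs) (νt (homogeneousComponent n f)) := by
  have key : ∀ s a, ∃ k, (monomial s a : MvPolynomial (Fin (d + 1)) F).IsHomogeneous k ∧
      ∀ n, gradCoeff F (TtAlg θ θs) n
        (Δ (cornerVal (F := F) (TtAlg.idem θ θs) (νt (monomial s a)))) =
        if n = k then cornerVal (F := F) (TtAlg.idem θ θs) (νt (monomial s a)) else 0 := by
    refine MvPolynomial.induction_on_monomial (motive := fun p => ∃ k, p.IsHomogeneous k ∧
      ∀ n, gradCoeff F (TtAlg θ θs) n
        (Δ (cornerVal (F := F) (TtAlg.idem θ θs) (νt p))) =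
        if n = k then cornerVal (F := F) (TtAlg.idem θ θs) (νt p) else 0) ?_ ?_
    · intro a
      refine ⟨0, isHomogeneous_C _ _, fun n => ?_⟩
      rw [algHom_C, Algebra.algebraMap_eq_smul_one, map_smul, cornerVal_one, map_smul, map_smul,
        gradCoeff_grading_one hes]
      split_ifs <;> simp
    · rintro p i ⟨k, hk, h⟩
      refine ⟨k + 1, hk.mul (isHomogeneous_X _ _), fun n => ?_⟩
      rw [mul_comm, map_mul, hν, cornerVal_mul, cornerVal_toCorner, map_mul,
        grading_corner he hes]
      cases n with
      | zero => rw [gradCoeff_zero_mul, if_neg (by omega)]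
      | succ n =>
        rw [gradCoeff_succ_mul, h]
        simp only [Nat.add_right_cancel_iff]
        split_ifs <;> simp
  induction f using MvPolynomial.induction_on' with
  | monomial s a =>
    obtain ⟨k, hk, h⟩ := key s a
    rw [h, homogeneousComponent_of_mem ((mem_homogeneousSubmodule k _).2 hk)]
    split_ifs <;> simp
  | add p q hp hq => simp only [map_add, hp, hq]

/-- A graded Nakayama argument: `corner_mem` alone only says that the `g_i` and `z` generate the
corner as a right ideal, but each `g_i` has degree one, so peeling it off lowers the degree and the
process ends. -/
theorem nuTilde_surjective (hθ : Function.Injective θ) (hθs : Function.Injective θs)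
    {νt : MvPolynomial (Fin (d + 1)) F →ₐ[F] TtCorner θ θs}
    (hν : IsNuTilde θ θs νt) : Function.Surjective νt := by
  obtain ⟨Δ, he, hes⟩ := exists_grading θ θs
  let S : Submodule F (TtAlg θ θs) :=
    LinearMap.range (cornerVal (F := F) (TtAlg.idem θ θs) ∘ₗ νt.toLinearMap)
  have hz : gen θ θs (.es 0) * gen θ θs (.es 0) = gen θ θs (.es 0) := TtAlg.idem θ θs
  have hmul : ∀ i, ∀ t ∈ S,
      gen θ θs (.es 0) * gen θ θs (.e i) * gen θ θs (.es 0) * t ∈ S := by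
    rintro i _ ⟨g, rfl⟩
    refine ⟨X i * g, ?_⟩
    simp only [LinearMap.comp_apply, AlgHom.toLinearMap_apply]
    rw [map_mul, hν, cornerVal_mul, cornerVal_toCorner]
  have hone : gen θ θs (.es 0) ∈ S := ⟨1, by
    simp only [LinearMap.comp_apply, AlgHom.toLinearMap_apply]
    rw [map_one, cornerVal_one]⟩
  have key : ∀ n t, gradCoeff F (TtAlg θ θs) n
      (Δ (gen θ θs (.es 0) * t * gen θ θs (.es 0))) ∈ S := by
    -- By `corner_mem`, it is enough to treat products with a left factor `g_i`; the term in `z` is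
    -- harmless.
    have hred : ∀ n, (∀ i a, gradCoeff F (TtAlg θ θs) n (Δ (gen θ θs (.es 0) * gen θ θs (.e i) *
        gen θ θs (.es 0) * (gen θ θs (.es 0) * a * gen θ θs (.es 0)))) ∈ S) →
        ∀ t, gradCoeff F (TtAlg θ θs) n (Δ (gen θ θs (.es 0) * t * gen θ θs (.es 0))) ∈ S := by
      intro n h t
      have h1 := (idempotentSystem hθ hθs).corner_mem t
      have h2 : ((⨆ i, LinearMap.range (LinearMap.mulLeft F
          (gen θ θs (.es 0) * gen θ θs (.e i) * gen θ θs (.es 0)))) ⊔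
          Submodule.span F {gen θ θs (.es 0)}) ≤
          S.comap (gradCoeff F (TtAlg θ θs) n ∘ₗ Δ.toLinearMap ∘ₗ
            LinearMap.mulRight F (gen θ θs (.es 0))) := by
        refine sup_le (iSup_le fun i => ?_) ?_
        · rintro _ ⟨a, rfl⟩
          have h3 : gen θ θs (.es 0) * gen θ θs (.e i) * gen θ θs (.es 0) * a *
              gen θ θs (.es 0) = gen θ θs (.es 0) * gen θ θs (.e i) * gen θ θs (.es 0) *
              (gen θ θs (.es 0) * a * gen θ θs (.es 0)) := by
            conv_lhs => rw [← hz]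
            simp only [mul_assoc]
            simp only [← mul_assoc _ (gen θ θs (.es 0)), hz]
          have := h i a
          rw [← h3] at this
          exact this
        · rw [Submodule.span_singleton_le_iff_mem]
          simp only [Submodule.mem_comap, LinearMap.comp_apply, LinearMap.mulRight_apply, hz,
            AlgHom.toLinearMap_apply]
          rw [gradCoeff_grading_one hes]
          split_ifs
          · exact hone
          · exact S.zero_mem
      have h4 := h2 h1
      simp only [Submodule.mem_comap, LinearMap.comp_apply, LinearMap.mulRight_apply,
        AlgHom.toLinearMap_apply, mul_assoc, hz] at h4
      rwa [mul_assoc]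
    intro n
    induction n with
    | zero =>
      refine hred _ fun i a => ?_
      rw [map_mul Δ, grading_corner he hes, gradCoeff_zero_mul]
      exact S.zero_mem
    | succ n ih =>
      refine hred _ fun i a => ?_
      rw [map_mul Δ, grading_corner he hes, gradCoeff_succ_mul]
      exact hmul i _ (ih a)
  intro r
  obtain ⟨t, rfl⟩ := exists_toCorner _ r
  have h1 := gradEval_mem S _ (fun n => key n t)
  rw [gradEval_grading he hes] at h1
  obtain ⟨g, hg⟩ := h1
  exact ⟨g, cornerVal_injective (F := F) _ hg⟩

end TtAlg

end Grading

-- The central element, and maps out of `T` into a corner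

namespace IdempotentSystem

variable {F A : Type*} [Field F] [Ring A] [Algebra F A] {d : ℕ}
  {x y : Fin (d + 1) → A} {θ θs : Fin (d + 1) → F}

theorem sum_mul_self {e : Fin (d + 1) → A} (he : ∀ i j, e i * e j = if i = j then e i else 0)
    (j : Fin (d + 1)) : (∑ i, e i) * e j = e j := by
  simp [Finset.sum_mul, he]

theorem mul_sum_self {e : Fin (d + 1) → A} (he : ∀ i j, e i * e j = if i = j then e i else 0)
    (j : Fin (d + 1)) : e j * (∑ i, e i) = e j := by
  simp [Finset.mul_sum, he]

theorem isIdempotentElem_sum {e : Fin (d + 1) → A}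
    (he : ∀ i j, e i * e j = if i = j then e i else 0) : IsIdempotentElem (∑ i, e i) := by
  rw [IsIdempotentElem, Finset.mul_sum]
  exact Finset.sum_congr rfl fun j _ => sum_mul_self he j

/-- For idempotents `u`, `v` the element `1 - (u - v)²` commutes with `u` and with `v`; for the
sums of the two families of an idempotent system it is central. -/
def centralElement (x y : Fin (d + 1) → A) : A := 1 - (∑ i, x i - ∑ i, y i) ^ 2

theorem centralElement_comm (x y : Fin (d + 1) → A) :
    centralElement x y = centralElement y x := by
  rw [centralElement, centralElement, ← neg_sub (∑ i, y i), neg_sq]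

/-- This is the relation for the constant polynomial `1`. -/
theorem x_mul_sum_y_mul_x (h : IdempotentSystem x y θ θs) {i j : Fin (d + 1)} (hij : i ≠ j) :
    x i * (∑ l, y l) * x j = 0 := by
  have := h.x_y_x i j 1 (by
    rw [Polynomial.natDegree_one, Nat.cast_zero, abs_pos, sub_ne_zero]
    exact fun h => hij (Fin.ext (by exact_mod_cast h)))
  simpa [Finset.mul_sum, Finset.sum_mul] using this

/-- Since `x_j u = x_j` and `v² = v`, expanding leaves `x_j v u`, whose terms off the diagonal
vanish. -/
theorem x_mul_centralElement (h : IdempotentSystem x y θ θs) (j : Fin (d + 1)) :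
    x j * centralElement x y = x j * (∑ l, y l) * x j := by
  have h1 : x j * (∑ l, y l) * (∑ i, x i) = x j * (∑ l, y l) * x j := by
    rw [Finset.mul_sum, Finset.sum_eq_single j]
    · exact fun i _ hi => h.x_mul_sum_y_mul_x hi.symm
    · simp
  have h2 := mul_sum_self h.x_mul j
  have h3 : (∑ l, y l) * (∑ l, y l) = ∑ l, y l := isIdempotentElem_sum h.y_mul
  rw [← h1, centralElement]
  generalize (∑ i, x i) = u at *
  generalize (∑ i, y i) = v at *
  have : x j * (1 - (u - v) ^ 2) =
    x j - (x j * u) * u + (x j * u) * v + x j * v * u - x j * (v * v) := by noncomm_ring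
  rw [this, h2, h3, h2]
  noncomm_ring

theorem centralElement_mul_x (h : IdempotentSystem x y θ θs) (j : Fin (d + 1)) :
    centralElement x y * x j = x j * (∑ l, y l) * x j := by
  have h1 : (∑ i, x i) * (∑ l, y l) * x j = x j * (∑ l, y l) * x j := by
    rw [Finset.sum_mul, Finset.sum_mul, Finset.sum_eq_single j]
    · exact fun i _ hi => h.x_mul_sum_y_mul_x hi
    · simp
  have h2 := sum_mul_self h.x_mul j
  have h3 : (∑ l, y l) * (∑ l, y l) = ∑ l, y l := isIdempotentElem_sum h.y_mul
  rw [← h1, centralElement]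
  generalize (∑ i, x i) = u at *
  generalize (∑ i, y i) = v at *
  have : (1 - (u - v) ^ 2) * x j =
    x j - u * (u * x j) + v * (u * x j) + u * v * x j - (v * v) * x j := by noncomm_ring
  rw [this, h2, h3, h2]
  noncomm_ring

theorem sum_y_mul_centralElement (hx : ∀ i j, x i * x j = if i = j then x i else 0)
    (hy : ∀ i j, y i * y j = if i = j then y i else 0) :
    (∑ l, y l) * centralElement x y = (∑ l, y l) * (∑ l, x l) * ∑ l, y l := by
  have h2 : (∑ l, x l) * (∑ l, x l) = ∑ l, x l := isIdempotentElem_sum hx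
  have h3 : (∑ l, y l) * (∑ l, y l) = ∑ l, y l := isIdempotentElem_sum hy
  rw [centralElement]
  generalize (∑ i, x i) = u at *
  generalize (∑ i, y i) = v at *
  have : v * (1 - (u - v) ^ 2) =
    v - v * (u * u) + v * u * v + (v * v) * u - (v * v) * v := by noncomm_ring
  rw [this, h2, h3, h3]
  noncomm_ring

/-- Left and right multiplication by `x_j` both give `x_j v x_j`. The element is symmetric in the
two families, so the same applies to each `y_j`, and these generate `A`. -/
theorem commute_centralElement (h : IdempotentSystem x y θ θs) (t : A) :
    Commute t (centralElement x y) := by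
  have ht : t ∈ Algebra.adjoin F (Set.range x ∪ Set.range y) := by rw [h.adjoin]; trivial
  induction ht using Algebra.adjoin_induction with
  | mem t ht =>
    rcases ht with ⟨i, rfl⟩ | ⟨j, rfl⟩
    · exact (h.x_mul_centralElement i).trans (h.centralElement_mul_x i).symm
    · rw [centralElement_comm]
      exact (h.swap.x_mul_centralElement j).trans (h.swap.centralElement_mul_x j).symm
  | algebraMap r => exact Algebra.commutes r _
  | add s t _ _ hs ht => exact hs.add_left ht
  | mul s t _ _ hs ht => exact hs.mul_left ht

end IdempotentSystem

namespace TAlg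

open IdempotentSystem

variable {F : Type*} [Field F] {d : ℕ} (θ θs : Fin (d + 1) → F)

/-- Two families that satisfy the relations of `T̃` and for which the sums `u`, `v` satisfy
`v u v = v` and `x_i v x_i = x_i` give a map from `T` to the corner at `v`. -/
theorem exists_to_corner {B : Type*} [Ring B] [Algebra F B] (x y : Fin (d + 1) → B)
    (hy : ∀ i j, y i * y j = if i = j then y i else 0)
    (h1 : ∀ (i j : Fin (d + 1)) (k : ℕ), (k : ℤ) < |(i : ℤ) - (j : ℤ)| →
      ∑ l, θ l ^ k • (y i * x l * y j) = 0)
    (h2 : ∀ (i j : Fin (d + 1)) (k : ℕ), (k : ℤ) < |(i : ℤ) - (j : ℤ)| →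
      ∑ l, θs l ^ k • (x i * y l * x j) = 0)
    (hv : (∑ l, y l) * (∑ l, x l) * (∑ l, y l) = ∑ l, y l)
    (hxvx : ∀ i j, x i * (∑ l, y l) * x j = if i = j then x i else 0)
    (idem : IsIdempotentElem (∑ l, y l)) :
    ∃ ψ : TAlg θ θs →ₐ[F] idem.Corner,
      (∀ i, cornerVal (F := F) idem (ψ (gen θ θs (.e i))) = (∑ l, y l) * x i * (∑ l, y l)) ∧
      ∀ i, cornerVal (F := F) idem (ψ (gen θ θs (.es i))) = y i := by
  have hyv := mul_sum_self hy
  have hvy := sum_mul_self hy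
  have hinj := cornerVal_injective (F := F) idem
  have hval : ∀ i, cornerVal (F := F) idem (toCorner idem (y i)) = y i := by
    intro i; rw [cornerVal_toCorner, hvy, hyv]
  have hvv : (∑ l, y l) * (∑ l, y l) = ∑ l, y l := idem
  have hvv' : ∀ t, (∑ l, y l) * ((∑ l, y l) * t) = (∑ l, y l) * t := by
    intro t; rw [← mul_assoc, hvv]
  refine (exists_lift θ θs (fun i => toCorner idem (x i)) (fun i => toCorner idem (y i))
    ?_ ?_ ?_ ?_ ?_ ?_).imp fun ψ hψ =>
      ⟨fun i => by rw [hψ.1, cornerVal_toCorner], fun i => by rw [hψ.2, hval]⟩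
  · intro i j
    apply hinj
    have : (∑ l, y l) * x i * (∑ l, y l) * ((∑ l, y l) * x j * (∑ l, y l)) =
        (∑ l, y l) * (x i * (∑ l, y l) * x j) * ∑ l, y l := by
      simp only [mul_assoc, hvv']
    rw [cornerVal_mul, cornerVal_toCorner, cornerVal_toCorner, this, hxvx]
    split_ifs
    · rw [cornerVal_toCorner]
    · simp
  · intro i j
    apply hinj
    rw [cornerVal_mul, hval, hval, hy]
    split_ifs
    · rw [hval]
    · simp
  · apply hinj
    rw [map_sum, cornerVal_one]
    simp only [cornerVal_toCorner]
    rw [← Finset.sum_mul, ← Finset.mul_sum, hv]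
  · apply hinj
    rw [map_sum, cornerVal_one]
    simp only [hval]
  · intro i j k hk
    apply hinj
    rw [map_sum, map_zero]
    simp only [map_smul, cornerVal_mul, hval, cornerVal_toCorner]
    rw [← h1 i j k hk]
    refine Finset.sum_congr rfl fun l _ => ?_
    congr 1
    calc y i * ((∑ l, y l) * x l * (∑ l, y l)) * y j
        = (y i * ∑ l, y l) * x l * ((∑ l, y l) * y j) := by simp only [mul_assoc]
      _ = _ := by rw [hyv, hvy]
  · intro i j k hk
    apply hinj
    rw [map_sum, map_zero]
    simp only [map_smul, cornerVal_mul, hval, cornerVal_toCorner]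
    have h3 : ∀ l, θs l ^ k • ((∑ l, y l) * x i * (∑ l, y l) * y l *
        ((∑ l, y l) * x j * ∑ l, y l)) =
        (∑ l, y l) * (θs l ^ k • (x i * y l * x j)) * ∑ l, y l := by
      intro l
      rw [mul_smul_comm, smul_mul_assoc]
      congr 1
      calc (∑ l, y l) * x i * (∑ l, y l) * y l * ((∑ l, y l) * x j * ∑ l, y l)
          = (∑ l, y l) * x i * ((∑ l, y l) * (y l * ∑ l, y l)) * (x j * ∑ l, y l) := by
            simp only [mul_assoc]
        _ = _ := by rw [hyv, hvy]; simp only [mul_assoc]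
    rw [Finset.sum_congr rfl fun l _ => h3 l, ← Finset.sum_mul, ← Finset.mul_sum, h2 i j k hk]
    simp

end TAlg

-- Dehomogenization

section Dehomogenize

variable {F : Type*} [Field F] {d : ℕ}

/-- The substitution `x_0 ↦ 1 - (x_1 + ⋯ + x_d)`. -/
noncomputable def dehomogenize (F : Type*) [Field F] (d : ℕ) :
    MvPolynomial (Fin (d + 1)) F →ₐ[F] MvPolynomial (Fin d) F :=
  aeval (Fin.cases (motive := fun _ => MvPolynomial (Fin d) F) (1 - ∑ i, X i) X)

theorem dehomogenize_X_zero : dehomogenize F d (X 0) = 1 - ∑ i, X i := by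
  simp [dehomogenize]

theorem dehomogenize_X_succ (i : Fin d) : dehomogenize F d (X i.succ) = X i := by
  simp [dehomogenize]

theorem dehomogenize_sum : dehomogenize F d (∑ i, X i - 1) = 0 := by
  rw [map_sub, map_sum, Fin.sum_univ_succ, dehomogenize_X_zero]
  simp [dehomogenize_X_succ]

theorem dehomogenize_rename (f : MvPolynomial (Fin d) F) :
    dehomogenize F d (rename Fin.succ f) = f := by
  have : (dehomogenize F d).comp (rename Fin.succ) = AlgHom.id F _ :=
    MvPolynomial.algHom_ext fun i => by simp [dehomogenize_X_succ]
  exact DFunLike.congr_fun this f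

theorem aeval_mul_of_isHomogeneous {K ι : Type*} [Field K] [Algebra F K] {f : MvPolynomial ι F}
    {n : ℕ} (hf : f.IsHomogeneous n) (c : K) (v : ι → K) :
    aeval (fun i => c * v i) f = c ^ n * aeval v f := by
  rw [aeval_def, aeval_def, eval₂_eq, eval₂_eq, Finset.mul_sum]
  refine Finset.sum_congr rfl fun s hs => ?_
  have h1 : ∑ i ∈ s.support, s i = n := by
    have := hf (mem_support_iff.1 hs)
    simpa [Finsupp.weight_apply, Finsupp.sum] using this
  simp only [mul_pow, Finset.prod_mul_distrib, Finset.prod_pow_eq_pow_sum, h1]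
  ring

/-- A form of degree `n` is recovered from its dehomogenization by substituting `x_i / ∑ x_j` and
multiplying by `(∑ x_j) ^ n`. -/
theorem eq_zero_of_dehomogenize_eq_zero {f : MvPolynomial (Fin (d + 1)) F} {n : ℕ}
    (hf : f.IsHomogeneous n) (h : dehomogenize F d f = 0) : f = 0 := by
  let K := FractionRing (MvPolynomial (Fin (d + 1)) F)
  let g : Fin (d + 1) → K := fun i => algebraMap (MvPolynomial (Fin (d + 1)) F) K (X i)
  have hinj : Function.Injective (algebraMap (MvPolynomial (Fin (d + 1)) F) K) :=
    IsFractionRing.injective _ _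
  have hs : ∑ i, g i ≠ 0 := by
    have h1 : ∑ i, (X i : MvPolynomial (Fin (d + 1)) F) ≠ 0 := by
      intro h0
      have := congrArg (MvPolynomial.eval (Pi.single 0 1)) h0
      simp [Pi.single_apply] at this
    rw [← map_sum]
    exact fun h0 => h1 (hinj (h0.trans (map_zero _).symm))
  let φ : MvPolynomial (Fin d) F →ₐ[F] K := aeval fun i => (∑ i, g i)⁻¹ * g i.succ
  have h1 : φ.comp (dehomogenize F d) = aeval fun i => (∑ i, g i)⁻¹ * g i := by
    refine MvPolynomial.algHom_ext fun i => ?_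
    refine Fin.cases ?_ (fun i => ?_) i
    · rw [AlgHom.comp_apply, dehomogenize_X_zero, aeval_X, map_sub, map_one, map_sum]
      simp only [φ, aeval_X]
      rw [← Finset.mul_sum, sub_eq_iff_eq_add, ← mul_add, ← Fin.sum_univ_succ, inv_mul_cancel₀ hs]
    · rw [AlgHom.comp_apply, dehomogenize_X_succ]
      simp only [φ, aeval_X]
  have h2 := DFunLike.congr_fun h1 f
  rw [AlgHom.comp_apply, h, map_zero, aeval_mul_of_isHomogeneous hf] at h2
  have h3 : (aeval g f : K) = algebraMap _ K f := by
    have : (aeval g : _ →ₐ[F] K) = IsScalarTower.toAlgHom F _ K :=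
      MvPolynomial.algHom_ext fun i => by simp [g]
    rw [this]; rfl
  rw [h3] at h2
  have h4 := (mul_eq_zero.1 h2.symm).resolve_left (pow_ne_zero _ (inv_ne_zero hs))
  exact hinj (h4.trans (map_zero _).symm)

end Dehomogenize

-- The change of variables between `μ` and `ν`

section LinearSubstitution

variable {F : Type*} [Field F] {d : ℕ}

/-- The substitution `x_i ↦ ∑ j, M i j x_j`. -/
noncomputable def linearSubstitution (M : Matrix (Fin d) (Fin d) F) :
    MvPolynomial (Fin d) F →ₐ[F] MvPolynomial (Fin d) F :=
  aeval fun i => ∑ j, M i j • X j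

theorem linearSubstitution_comp (M N : Matrix (Fin d) (Fin d) F) :
    (linearSubstitution M).comp (linearSubstitution N) = linearSubstitution (N * M) := by
  refine MvPolynomial.algHom_ext fun i => ?_
  simp only [linearSubstitution, AlgHom.comp_apply, aeval_X, map_sum, map_smul, Finset.smul_sum,
    Matrix.mul_apply, Finset.sum_smul, mul_smul]
  exact Finset.sum_comm

theorem linearSubstitution_one :
    linearSubstitution (1 : Matrix (Fin d) (Fin d) F) = AlgHom.id F _ := by
  refine MvPolynomial.algHom_ext fun i => ?_
  simp [linearSubstitution, Matrix.one_apply]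

theorem linearSubstitution_bijective {M : Matrix (Fin d) (Fin d) F} (hM : IsUnit M.det) :
    Function.Bijective (linearSubstitution M) := by
  rw [Function.bijective_iff_has_inverse]
  refine ⟨linearSubstitution M⁻¹, fun f => ?_, fun f => ?_⟩
  · rw [← AlgHom.comp_apply, linearSubstitution_comp, Matrix.mul_nonsing_inv _ hM,
      linearSubstitution_one, AlgHom.id_apply]
  · rw [← AlgHom.comp_apply, linearSubstitution_comp, Matrix.nonsing_inv_mul _ hM,
      linearSubstitution_one, AlgHom.id_apply]

theorem tauPoly_eval (θ : Fin (d + 1) → F) (i j : Fin (d + 1)) :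
    (tauPoly θ i).eval (θ j) =
      ∏ h ∈ Finset.univ.filter (fun h : Fin (d + 1) => h < i), (θ j - θ h) := by
  simp [tauPoly, Polynomial.eval_prod]

theorem tauPoly_eval_eq_zero (θ : Fin (d + 1) → F) {i j : Fin (d + 1)} (h : j < i) :
    (tauPoly θ i).eval (θ j) = 0 := by
  rw [tauPoly_eval]
  exact Finset.prod_eq_zero (Finset.mem_filter.2 ⟨Finset.mem_univ _, h⟩) (sub_self _)

/-- The coefficients `τ_i(θ_j)` of the change of variables between `μ` and `ν`. -/
noncomputable def tauMatrix (θ : Fin (d + 1) → F) : Matrix (Fin d) (Fin d) F :=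
  Matrix.of fun i j => (tauPoly θ i.succ).eval (θ j.succ)

/-- The matrix is triangular because `τ_i` vanishes at the earlier nodes; its diagonal entries are
products of differences of distinct `θ`. -/
theorem isUnit_det_tauMatrix {θ : Fin (d + 1) → F} (hθ : Function.Injective θ) :
    IsUnit (tauMatrix θ).det := by
  rw [Matrix.det_of_isUpperTriangular, isUnit_iff_ne_zero, Finset.prod_ne_zero_iff]
  · intro i _
    rw [tauMatrix, Matrix.of_apply, tauPoly_eval, Finset.prod_ne_zero_iff]
    intro h hh
    rw [sub_ne_zero]
    exact fun h0 => (Finset.mem_filter.1 hh).2.ne (hθ h0).symm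
  · intro i j hij
    exact tauPoly_eval_eq_zero θ (Fin.succ_lt_succ_iff.2 hij)

end LinearSubstitution

-- Existence of the three maps and comparison of their kernels

section Main

variable {F : Type*} [Field F] {d : ℕ} {θ θs : Fin (d + 1) → F}

theorem TtAlg.toCorner_e_comm (hθ : Function.Injective θ) (hθs : Function.Injective θs)
    (i j : Fin (d + 1)) :
    toCorner (TtAlg.idem θ θs) (gen θ θs (.e i)) * toCorner (TtAlg.idem θ θs) (gen θ θs (.e j)) =
      toCorner (TtAlg.idem θ θs) (gen θ θs (.e j)) *
        toCorner (TtAlg.idem θ θs) (gen θ θs (.e i)) :=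
  Subtype.ext ((idempotentSystem hθ hθs).commute_corner i j)

theorem TAlg.toCorner_e_comm (hθ : Function.Injective θ) (hθs : Function.Injective θs)
    (i j : Fin (d + 1)) :
    toCorner (TAlg.idem θ θs) (gen θ θs (.e i)) * toCorner (TAlg.idem θ θs) (gen θ θs (.e j)) =
      toCorner (TAlg.idem θ θs) (gen θ θs (.e j)) *
        toCorner (TAlg.idem θ θs) (gen θ θs (.e i)) := by
  obtain ⟨π, he, hes, -⟩ := exists_projection θ θs
  have h := congrArg π ((TtAlg.idempotentSystem hθ hθs).commute_corner i j)
  simp only [map_mul, he, hes] at h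
  exact Subtype.ext h

theorem existsUnique_isNuTilde (hθ : Function.Injective θ) (hθs : Function.Injective θs) :
    ∃! νt : MvPolynomial (Fin (d + 1)) F →ₐ[F] TtCorner θ θs, IsNuTilde θ θs νt :=
  existsUnique_mvPolynomial_algHom _ (TtAlg.toCorner_e_comm hθ hθs)

theorem existsUnique_isNu (hθ : Function.Injective θ) (hθs : Function.Injective θs) :
    ∃! ν : MvPolynomial (Fin d) F →ₐ[F] TCorner θ θs, IsNu θ θs ν :=
  existsUnique_mvPolynomial_algHom _ fun i j => TAlg.toCorner_e_comm hθ hθs i.succ j.succ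

theorem IsNu.map_one_sub_sum {ν : MvPolynomial (Fin d) F →ₐ[F] TCorner θ θs}
    (hν : IsNu θ θs ν) :
    ν (1 - ∑ i, X i) = toCorner (TAlg.idem θ θs) (TAlg.gen θ θs (.e 0)) := by
  apply cornerVal_injective (F := F)
  have hz : TAlg.gen θ θs (.es 0) * TAlg.gen θ θs (.es 0) = TAlg.gen θ θs (.es 0) :=
    TAlg.idem θ θs
  have h := TAlg.e_sum θ θs
  rw [Fin.sum_univ_succ, ← eq_sub_iff_add_eq] at h
  rw [map_sub, map_one, map_sum, map_sub, cornerVal_one, map_sum]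
  simp only [hν _, cornerVal_toCorner]
  rw [h, mul_sub, sub_mul, mul_one, hz, Finset.mul_sum, Finset.sum_mul]

/-- Expand `τ_i(a) = ∑ τ_i(θ_j) e_j`. For `i ≥ 1` the term in `e_0` drops out, so no constant
appears in the substitution. -/
theorem IsNu.map_aeval_tauPoly {ν : MvPolynomial (Fin d) F →ₐ[F] TCorner θ θs}
    (hν : IsNu θ θs ν) (i : Fin d) :
    ν (linearSubstitution (tauMatrix θ) (X i)) = toCorner (TAlg.idem θ θs)
      (Polynomial.aeval (TAlg.gen θ θs TGen.a) (tauPoly θ i.succ)) := by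
  apply cornerVal_injective (F := F)
  rw [TAlg.a_eq, aeval_sum_smul θ (TAlg.e_mul θ θs) (TAlg.e_sum θ θs), cornerVal_toCorner,
    Fin.sum_univ_succ, tauPoly_eval_eq_zero θ (Fin.succ_pos i), zero_smul, zero_add]
  simp only [linearSubstitution, aeval_X, map_sum, map_smul, hν _, cornerVal_toCorner,
    Finset.mul_sum, Finset.sum_mul, mul_smul_comm, smul_mul_assoc]
  rfl

theorem existsUnique_isMu (hθ : Function.Injective θ) (hθs : Function.Injective θs) :
    ∃! μ : MvPolynomial (Fin d) F →ₐ[F] TCorner θ θs, IsMu θ θs μ := by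
  obtain ⟨ν, hν, -⟩ := existsUnique_isNu hθ hθs
  refine ⟨ν.comp (linearSubstitution (tauMatrix θ)), fun i => hν.map_aeval_tauPoly i, ?_⟩
  exact fun μ hμ => MvPolynomial.algHom_ext fun i =>
    (hμ i).trans (hν.map_aeval_tauPoly i).symm

theorem bijective_mu_iff_bijective_nu (hθ : Function.Injective θ)
    {μ ν : MvPolynomial (Fin d) F →ₐ[F] TCorner θ θs} (hμ : IsMu θ θs μ) (hν : IsNu θ θs ν) :
    Function.Bijective μ ↔ Function.Bijective ν := by
  have h : μ = ν.comp (linearSubstitution (tauMatrix θ)) := MvPolynomial.algHom_ext fun i =>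
    (hμ i).trans (hν.map_aeval_tauPoly i).symm
  rw [h, AlgHom.coe_comp]
  exact Function.Bijective.of_comp_iff _
    (linearSubstitution_bijective (isUnit_det_tauMatrix hθ))

/-- In `T` the `e_i` sum to `1`, so the image of `x_0` is forced to be that of `1 - (x_1 + ⋯ +
x_d)`. -/
theorem nu_dehomogenize {π : TtAlg θ θs →ₐ[F] TAlg θ θs}
    (he : ∀ i, π (TtAlg.gen θ θs (.e i)) = TAlg.gen θ θs (.e i))
    (hes : ∀ i, π (TtAlg.gen θ θs (.es i)) = TAlg.gen θ θs (.es i))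
    {ν : MvPolynomial (Fin d) F →ₐ[F] TCorner θ θs}
    {νt : MvPolynomial (Fin (d + 1)) F →ₐ[F] TtCorner θ θs}
    (hν : IsNu θ θs ν) (hνt : IsNuTilde θ θs νt) (f : MvPolynomial (Fin (d + 1)) F) :
    ν (dehomogenize F d f) = cornerMap π (TtAlg.idem θ θs) (TAlg.idem θ θs) (hes 0) (νt f) := by
  have key : ν.comp (dehomogenize F d) =
      (cornerMap π (TtAlg.idem θ θs) (TAlg.idem θ θs) (hes 0)).comp νt := by
    refine MvPolynomial.algHom_ext fun i => ?_
    rw [AlgHom.comp_apply, AlgHom.comp_apply, hνt]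
    have h1 : cornerMap π (TtAlg.idem θ θs) (TAlg.idem θ θs) (hes 0)
        (toCorner (TtAlg.idem θ θs) (TtAlg.gen θ θs (.e i))) =
        toCorner (TAlg.idem θ θs) (TAlg.gen θ θs (.e i)) := by
      apply cornerVal_injective (F := F)
      rw [cornerVal_cornerMap, cornerVal_toCorner, cornerVal_toCorner, map_mul, map_mul, he, hes]
    rw [h1]
    refine Fin.cases ?_ (fun i => ?_) i
    · rw [dehomogenize_X_zero, hν.map_one_sub_sum]
    · rw [dehomogenize_X_succ, hν]
  exact DFunLike.congr_fun key f

theorem nu_surjective (hθ : Function.Injective θ) (hθs : Function.Injective θs)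
    {ν : MvPolynomial (Fin d) F →ₐ[F] TCorner θ θs} (hν : IsNu θ θs ν) :
    Function.Surjective ν := by
  obtain ⟨π, he, hes, hsurj⟩ := TAlg.exists_projection θ θs
  obtain ⟨νt, hνt, -⟩ := existsUnique_isNuTilde hθ hθs
  intro r
  obtain ⟨t, rfl⟩ := exists_toCorner _ r
  obtain ⟨t, rfl⟩ := hsurj t
  obtain ⟨g, hg⟩ := TtAlg.nuTilde_surjective hθ hθs hνt (toCorner (TtAlg.idem θ θs) t)
  refine ⟨dehomogenize F d g, ?_⟩
  rw [nu_dehomogenize he hes hν hνt, hg]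
  apply cornerVal_injective (F := F)
  rw [cornerVal_cornerMap, cornerVal_toCorner, cornerVal_toCorner, map_mul, map_mul, hes]

/-- The grading makes the kernel of `ν̃` homogeneous, and a form whose dehomogenization vanishes is
zero. -/
theorem nuTilde_injective_of_nu_injective
    {ν : MvPolynomial (Fin d) F →ₐ[F] TCorner θ θs}
    {νt : MvPolynomial (Fin (d + 1)) F →ₐ[F] TtCorner θ θs}
    (hν : IsNu θ θs ν) (hνt : IsNuTilde θ θs νt) (hinj : Function.Injective ν) :
    Function.Injective νt := by
  obtain ⟨π, he, hes, -⟩ := TAlg.exists_projection θ θs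
  obtain ⟨Δ, hΔe, hΔes⟩ := TtAlg.exists_grading θ θs
  rw [injective_iff_map_eq_zero]
  intro f hf
  rw [← sum_homogeneousComponent f]
  refine Finset.sum_eq_zero fun n _ => ?_
  have h1 : νt (homogeneousComponent n f) = 0 := by
    apply cornerVal_injective (F := F)
    rw [← TtAlg.gradCoeff_nuTilde hΔe hΔes hνt, hf]
    simp
  have h2 := nu_dehomogenize he hes hν hνt (homogeneousComponent n f)
  rw [h1, map_zero] at h2
  exact eq_zero_of_dehomogenize_eq_zero (homogeneousComponent_isHomogeneous n f)
    (hinj (h2.trans (map_zero ν).symm))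

theorem IsNuTilde.map_sum_sub_one {νt : MvPolynomial (Fin (d + 1)) F →ₐ[F] TtCorner θ θs}
    (hνt : IsNuTilde θ θs νt) :
    cornerVal (F := F) (TtAlg.idem θ θs) (νt (∑ i, X i - 1)) =
      TtAlg.gen θ θs (.es 0) * (∑ i, TtAlg.gen θ θs (.e i)) * TtAlg.gen θ θs (.es 0) -
        TtAlg.gen θ θs (.es 0) := by
  rw [map_sub, map_one, map_sum, map_sub, cornerVal_one, map_sum]
  simp only [hνt _, cornerVal_toCorner]
  rw [Finset.mul_sum, Finset.sum_mul]

open IdempotentSystem in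
/-- If `ν f = 0` then `ν̃ f` is a left multiple of `s - 1` for the central element `s`. -/
theorem exists_nuTilde_eq_mul_of_nu_eq_zero (hθ : Function.Injective θ)
    (hθs : Function.Injective θs) {ν : MvPolynomial (Fin d) F →ₐ[F] TCorner θ θs}
    {νt : MvPolynomial (Fin (d + 1)) F →ₐ[F] TtCorner θ θs}
    (hν : IsNu θ θs ν) (hνt : IsNuTilde θ θs νt) {f : MvPolynomial (Fin d) F} (hf : ν f = 0) :
    ∃ a, a * (centralElement (fun i => TtAlg.gen θ θs (.e i))
        (fun i => TtAlg.gen θ θs (.es i)) - 1) =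
      cornerVal (F := F) (TtAlg.idem θ θs) (νt (rename Fin.succ f)) := by
  have hsys := TtAlg.idempotentSystem hθ hθs
  have hcomm := hsys.commute_centralElement
  have hxs := hsys.x_mul_centralElement
  have hvs := sum_y_mul_centralElement hsys.x_mul hsys.y_mul
  set s := centralElement (fun i => TtAlg.gen θ θs (.e i)) (fun i => TtAlg.gen θ θs (.es i))
    with hs
  -- A left ideal by definition, two-sided because `s` is central. In the quotient `v u v = v s = v`
  -- and `x_i v x_i = x_i s = x_i`, as `exists_to_corner` requires.
  let I : Ideal (TtAlg θ θs) := Ideal.span {s - 1}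
  have hI : I.IsTwoSided := ⟨fun {a} b ha => by
    obtain ⟨c, rfl⟩ := Ideal.mem_span_singleton'.1 ha
    refine Ideal.mem_span_singleton'.2 ⟨c * b, ?_⟩
    rw [mul_assoc, mul_assoc, mul_sub, sub_mul, mul_one, one_mul, (hcomm b).eq]⟩
  let q : TtAlg θ θs →ₐ[F] TtAlg θ θs ⧸ I := Ideal.Quotient.mkₐ F I
  have hq1 : q s = 1 := by
    rw [← map_one q, ← sub_eq_zero, ← map_sub]
    exact Ideal.Quotient.eq_zero_iff_mem.2 (Ideal.mem_span_singleton_self _)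
  have hy : ∀ i j, q (TtAlg.gen θ θs (.es i)) * q (TtAlg.gen θ θs (.es j)) =
      if i = j then q (TtAlg.gen θ θs (.es i)) else 0 := by
    intro i j
    rw [← map_mul, TtAlg.es_mul]
    split_ifs <;> simp
  obtain ⟨ψ, hψe, hψes⟩ := TAlg.exists_to_corner θ θs (fun i => q (TtAlg.gen θ θs (.e i)))
    (fun i => q (TtAlg.gen θ θs (.es i))) hy
    (fun i j k hk => by
      simp only [← map_mul, ← map_smul, ← map_sum]
      rw [TtAlg.es_sum_es θ θs i j k hk, map_zero])
    (fun i j k hk => by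
      simp only [← map_mul, ← map_smul, ← map_sum]
      rw [TtAlg.e_sum_e θ θs i j k hk, map_zero])
    (by
      simp only [← map_mul, ← map_sum]
      rw [← hvs, map_mul, hq1, mul_one])
    (fun i j => by
      simp only [← map_mul, ← map_sum]
      split_ifs with hij
      · subst hij
        rw [← hxs, map_mul, hq1, mul_one]
      · rw [hsys.x_mul_sum_y_mul_x hij, map_zero])
    (isIdempotentElem_sum hy)
  have hyv := mul_sum_self hy 0
  have hvy := sum_mul_self hy 0
  have key : ∀ f : MvPolynomial (Fin d) F,
      cornerVal (F := F) (isIdempotentElem_sum hy)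
        (ψ (cornerVal (F := F) (TAlg.idem θ θs) (ν f))) =
      q (cornerVal (F := F) (TtAlg.idem θ θs) (νt (rename Fin.succ f))) := by
    intro f
    induction f using MvPolynomial.induction_on with
    | C a =>
      rw [rename_C, algHom_C, algHom_C, Algebra.algebraMap_eq_smul_one,
        Algebra.algebraMap_eq_smul_one]
      simp only [map_smul]
      rw [cornerVal_one, cornerVal_one, hψes]
    | add p p' hp hp' => simp only [map_add, hp, hp']
    | mul_X p i hp =>
      simp only [map_mul, rename_X, hν _, hνt _, cornerVal_mul, cornerVal_toCorner, hp, hψe, hψes]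
      congr 1
      simp only [mul_assoc, hvy]
      simp only [← mul_assoc, hyv]
  have h0 := key f
  rw [hf, map_zero, map_zero, map_zero] at h0
  exact Ideal.mem_span_singleton'.1 (Ideal.Quotient.eq_zero_iff_mem.1 h0.symm)

theorem nu_injective_of_nuTilde_injective (hθ : Function.Injective θ)
    (hθs : Function.Injective θs) {ν : MvPolynomial (Fin d) F →ₐ[F] TCorner θ θs}
    {νt : MvPolynomial (Fin (d + 1)) F →ₐ[F] TtCorner θ θs}
    (hν : IsNu θ θs ν) (hνt : IsNuTilde θ θs νt) (hinj : Function.Injective νt) :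
    Function.Injective ν := by
  rw [injective_iff_map_eq_zero]
  intro f hf
  obtain ⟨a, ha⟩ := exists_nuTilde_eq_mul_of_nu_eq_zero hθ hθs hν hνt hf
  obtain ⟨g, hg⟩ := TtAlg.nuTilde_surjective hθ hθs hνt (toCorner (TtAlg.idem θ θs) a)
  have hsys := TtAlg.idempotentSystem hθ hθs
  have hz : TtAlg.gen θ θs (.es 0) * TtAlg.gen θ θs (.es 0) = TtAlg.gen θ θs (.es 0) :=
    TtAlg.idem θ θs
  have hsz := hsys.swap.centralElement_mul_x 0
  rw [IdempotentSystem.centralElement_comm] at hsz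
  -- With `z = ε*_0`, multiplying `a (s - 1)` by `z` on both sides gives `(z a z)(z u z - z)`,
  -- because `s z = z u z`; the two factors are the images of `g` and of `∑ x_i - 1`.
  have h1 : νt (rename Fin.succ f) = νt (g * (∑ i, X i - 1)) := by
    apply cornerVal_injective (F := F)
    rw [map_mul, cornerVal_mul, hg, cornerVal_toCorner, hνt.map_sum_sub_one,
      ← mul_cornerVal_mul (F := F) _ (νt (rename Fin.succ f)), ← ha, mul_assoc _ _
      (TtAlg.gen θ θs (.es 0)), mul_assoc a, sub_mul, one_mul, hsz, mul_assoc _ (TtAlg.gen θ θs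
      (.es 0)), mul_sub (TtAlg.gen θ θs (.es 0)), hz, ← mul_assoc (TtAlg.gen θ θs (.es 0)),
      ← mul_assoc (TtAlg.gen θ θs (.es 0)), ← mul_assoc (TtAlg.gen θ θs (.es 0)), hz]
  have h2 := congrArg (dehomogenize F d) (hinj h1)
  rwa [dehomogenize_rename, map_mul, dehomogenize_sum, mul_zero] at h2

theorem bijective_nu_iff_bijective_nuTilde (hθ : Function.Injective θ)
    (hθs : Function.Injective θs) {ν : MvPolynomial (Fin d) F →ₐ[F] TCorner θ θs}
    {νt : MvPolynomial (Fin (d + 1)) F →ₐ[F] TtCorner θ θs}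
    (hν : IsNu θ θs ν) (hνt : IsNuTilde θ θs νt) :
    Function.Bijective ν ↔ Function.Bijective νt :=
  ⟨fun h => ⟨nuTilde_injective_of_nu_injective hν hνt h.1,
    TtAlg.nuTilde_surjective hθ hθs hνt⟩,
  fun h => ⟨nu_injective_of_nuTilde_injective hθ hθs hν hνt h.1, nu_surjective hθ hθs hν⟩⟩

end Main

theorem mainTheorem8 {F : Type*} [Field F] (d : ℕ) (θ θs : Fin (d + 1) → F)
    (hp : Feasible θ θs) :
    (∃! μ : MvPolynomial (Fin d) F →ₐ[F] TCorner θ θs, IsMu θ θs μ) ∧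
    (∃! ν : MvPolynomial (Fin d) F →ₐ[F] TCorner θ θs, IsNu θ θs ν) ∧
    (∃! νt : MvPolynomial (Fin (d + 1)) F →ₐ[F] TtCorner θ θs, IsNuTilde θ θs νt) ∧
    ∀ (μ ν : MvPolynomial (Fin d) F →ₐ[F] TCorner θ θs)
      (νt : MvPolynomial (Fin (d + 1)) F →ₐ[F] TtCorner θ θs),
      IsMu θ θs μ → IsNu θ θs ν → IsNuTilde θ θs νt →
        (Function.Bijective μ ↔ Function.Bijective ν) ∧
        (Function.Bijective ν ↔ Function.Bijective νt) ∧
        (Function.Bijective μ ↔ Function.Bijective νt) := by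
  have hθ := hp.inj
  have hθs := hp.inj_star
  refine ⟨existsUnique_isMu hθ hθs, existsUnique_isNu hθ hθs, existsUnique_isNuTilde hθ hθs, ?_⟩
  intro μ ν νt hμ hν hνt
  have h1 := bijective_mu_iff_bijective_nu hθ hμ hν
  have h2 := bijective_nu_iff_bijective_nuTilde hθ hθs hν hνt
  exact ⟨h1, h2, h1.trans h2⟩
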